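/- **Setting.** Fix real numbers $\chi\in(0,1)$, $\rho,\varepsilon\in[0,1)$ (not both $\rho=0$ and $\varepsilon=0$), $\mu\in(0,1)$, $\eta_s,\mathcal P_{\rm th},\sigma_r^2,\sigma_{rb}^2,\sigma_t^2,\gamma_A>0$, $\flat>0$, $\Omega\ge 0$, an integer $m_{sr}\ge1$, $K\ge0$, $\nu>0$, $w_e>0$, $w_r\ge0$, $w_{\min}>0$, $0<h_1<h_2$ and $0<\phi<\pi/2$. Put $$\chi_{\rho,\varepsilon}=\chi\Big(\tfrac{2\rho}{1-\rho}+\varepsilon\Big),\quad \mu_\varepsilon=\mu\Big(\sigma_r^2+\tfrac{\sigma_{rb}^2}{1-\varepsilon}\Big),\quad \mu'=\tfrac{\mu}{1-\mu},\quad C=\chi_{\rho,\varepsilon}\eta_s\big((1-\mu)-\mu\gamma_A\big),\quad D=\mu_\varepsilon\chi_{\rho,\varepsilon}\gamma_A,$$ $$\mathcal P_{C,D}=\tfrac{\mathcal P_{\rm th}C}{\eta_s}-D,\quad \Theta=(1+K)\sigma_t^2\gamma_A,\quad w_{er}=w_e+w_r,\quad w_{\max}=\sqrt{w_{\min}^2+2w_{er}w_{\min}},$$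 $$\alpha=\frac1{2\flat}\Big(\frac{2\flat m_{sr}}{2\flat m_{sr}+\Omega}\Big)^{m_{sr}},\quad \delta=\frac{\Omega}{2\flat(2\flat m_{sr}+\Omega)},\quad \bar\beta=\frac1{2\flat}-\delta,\quad \zeta(k)=\frac{(-1)^k(1-m_{sr})_k\,\delta^k}{(k!)^2}.$$ The aerial transmitter $R$ is at distance $w_{er}$ from the centre of the Earth. The satellite $S$ is uniformly distributed (with respect to area) on the part of the sphere of radius $w_{er}+w_{\min}$ about the centre of the Earth that lies above the horizontal plane through $R$. The aerial receiver $T$ is uniformly distributed (with respect to volume) in the truncated cone with apex $R$, vertical axis, half-angle $\phi$, consisting of the points of the downward cone whose depth below $R$ is between $h_1$ and $h_2$. The channel $g_{sr}$ is shadowed-Rician and $g_{rt}$ is Rician, i.e. $|g_{sr}|^2$ and $|g_{rt}|^2$ have on $[0,\infty)$ the densities $$\alpha\sum_{k=0}^{m_{sr}-1}\zeta(k)x^ke^{-\bar\beta x},\qquad (1+K)e^{-K-(1+K)x}I_0\big(2\sqrt{K(1+K)x}\big).$$ The variables $|g_{sr}|^2$, $w_{sr}=|SR|$, $|g_{rt}|^2$,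 $w_{rt}=|RT|$ are independent. Write $\sigma=\eta_s|g_{sr}|^2w_{sr}^{-2}$ and $y=|g_{rt}|^2w_{rt}^{-\nu}$. With imperfect interference cancellation, the signal-to-noise ratio at $T$ in the linear region of the energy harvester is $$\Lambda_{T,1}=\frac{(1-\mu)\chi_{\rho,\varepsilon}\,\sigma y}{\mu_\varepsilon\chi_{\rho,\varepsilon}\,y+\mu\chi_{\rho,\varepsilon}\,\sigma y+\sigma_t^2},\qquad\text{and}\qquad P_3(\gamma_A)=\Pr\big[\Lambda_{T,1}>\gamma_A,\ \sigma\le\mathcal P_{\rm th}\big].$$ **Theorem.** $$P_3(\gamma_A)=\begin{cases}\widetilde\Psi_1(\gamma_A),&\gamma_A<1/\mu'\text{ and }\mathcal P_{\rm th}\ge (D/C)\eta_s,\\ 0,&\gamma_A<1/\mu'\text{ and }\mathcal P_{\rm th}<(D/C)\eta_s,\\ 0,&\gamma_A\ge1/\mu',\end{cases}$$ where, with $\varsigma_1=1+k_1+k_2-n$ and $\Delta_\Gamma(a,b,c)=\Gamma(a,b)-\Gamma(a,c)$ (upper incomplete Gamma functions), $$\widetilde\Psi_1(\gamma_A)=\frac{3C\alpha}{w_{er}w_{\min}\,\nu\,(h_2^3-h_1^3)\tan^2\phi}\sum_{k=0}^{m_{sr}-1}\sum_{m=0}^{\infty}\sum_{n=0}^{m}\sum_{k_1=0}^{k}\sum_{k_2=0}^\infty\frac{\zeta(k)e^{-K}}{\bar\beta^{k+2}}\,\frac{K^m\Theta^n}{m!\,n!}\binom{k}{k_1}\frac{(-1)^{k_2}}{k_2!}\,\frac{\mathcal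 P_{C,D}^{\varsigma_1}}{D^{k_1+k_2+2}}\;\Delta_\Gamma\Big(k+k_2+2,\tfrac{\bar\beta Dw_{\min}^2}{C},\tfrac{\bar\beta Dw_{\max}^2}{C}\Big)\,B_{n,\varsigma_1}.$$ Here, with $$\mathcal G_j(h)=h^{\nu n+j}\,G^{2,1}_{2,3}\left[\frac{\Theta h^\nu}{\mathcal P_{C,D}}\,\middle|\,{1-n-\frac j\nu,\ \varsigma_1+1\atop \varsigma_1,\ 0,\ -n-\frac j\nu}\right]$$ ($G$ is the Meijer G-function), $$B_{n,\varsigma_1}=\mathcal G_3(h_2)-\mathcal G_3(h_1)-h_1\mathcal G_2\big(\tfrac{h_1}{\cos\phi}\big)+h_1\mathcal G_2(h_1)-\cos\phi\,\mathcal G_3\big(\tfrac{h_2}{\cos\phi}\big)+\cos\phi\,\mathcal G_3\big(\tfrac{h_1}{\cos\phi}\big)+h_2\mathcal G_2\big(\tfrac{h_2}{\cos\phi}\big)-h_2\mathcal G_2(h_2).$$ For each $k$ and $k_1$, the series over $(m,n,k_2)$ with $n\le m$ converges absolutely. In the boundary case $\mathcal P_{\rm th}=(D/C)\eta_s$, where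 $\mathcal P_{C,D}=0$, every term of the series is read as its limit $0$ for $\mathcal P_{C,D}\downarrow0$. -/

import Mathlib

open MeasureTheory ProbabilityTheory

noncomputable section

namespace A2A

/-! ### Special functions -/

/-- The integrand of the Mellin-Barnes integral of the Meijer G-function with upper parameters
`a₁, a₂` (the first `n` and the remaining `p - n`) and lower parameters `b₁, b₂` (the first `m`
and the remaining `q - m`). The junk values `Complex.Gamma (-j) = 0` and `x / 0 = 0` agree with
the zeros of the entire function `1 / Γ` in the denominator. -/
def meijerIntegrand (a₁ a₂ b₁ b₂ : List ℂ) (z s : ℂ) : ℂ :=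
  (b₁.map fun b => Complex.Gamma (b - s)).prod * (a₁.map fun a => Complex.Gamma (1 - a + s)).prod
    / ((b₂.map fun b => Complex.Gamma (1 - b + s)).prod
        * (a₂.map fun a => Complex.Gamma (a - s)).prod) * z ^ s

open scoped Classical in
/-- The Meijer G-function `G^{m,n}_{p,q}[z | a₁, a₂; b₁, b₂]`,
`(1 / 2πi) ∫_L (∏ Γ(b₁ - s) ∏ Γ(1 - a₁ + s)) / (∏ Γ(1 - b₂ + s) ∏ Γ(a₂ - s)) z ^ s ds`,
where `L` runs along a vertical line `Re s = c`, from `c - i∞` to `c + i∞`, which has all the poles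
of the `Γ(b₁ - s)` on its right and all the poles of the `Γ(1 - a₁ + s)` on its left
(value `0` if no vertical line separates these poles). -/
def meijerG (a₁ a₂ b₁ b₂ : List ℂ) (z : ℂ) : ℂ :=
  if h : ∃ c : ℝ, (∀ a ∈ a₁, a.re - 1 < c) ∧ (∀ b ∈ b₁, c < b.re) then
    (1 / (2 * Real.pi) : ℂ) * ∫ t : ℝ, meijerIntegrand a₁ a₂ b₁ b₂ z (h.choose + t * Complex.I)
  else 0

/-- The upper incomplete Gamma function `Γ(s, x)`. -/
def upperGamma (s x : ℝ) : ℝ := ∫ t in Set.Ioi x, t ^ (s - 1) * Real.exp (-t)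

/-- `Δ_Γ(a, b, c) = Γ(a, b) - Γ(a, c)`. -/
def deltaGamma (a b c : ℝ) : ℝ := upperGamma a b - upperGamma a c

/-- The zeroth-order modified Bessel function of the first kind. -/
def besselI0 (z : ℝ) : ℝ := ∑' m : ℕ, 1 / (m.factorial : ℝ) ^ 2 * (z / 2) ^ (2 * m)

/-! ### System parameters -/

/-- The numerical parameters of the network. -/
structure Params where
  /-- energy conversion efficiency -/
  χ : ℝ
  /-- time splitting factor -/
  ρ : ℝ
  /-- power splitting factor -/
  ε : ℝ
  /-- spectrum sharing factor -/
  μ : ℝ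
  /-- `η_s`, the transmit power of the satellite times antenna gains and free-space loss factor -/
  η : ℝ
  /-- saturation threshold power of the harvester -/
  Pth : ℝ
  /-- variance `σ_r²` of the antenna noise at the aerial transmitter -/
  varR : ℝ
  /-- variance `σ_rb²` of its RF-to-baseband conversion noise -/
  varRB : ℝ
  /-- variance `σ_t²` of the noise at the aerial receiver -/
  varT : ℝ
  /-- target threshold `γ_A` -/
  γ : ℝ
  /-- half the average power of the multipath component of the satellite link -/
  b : ℝ
  /-- average power of the line-of-sight component of the satellite link -/
  Om : ℝ
  /-- fading severity of the satellite link -/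
  msr : ℕ
  /-- Rician factor of the air-to-air link -/
  K : ℝ
  /-- path loss exponent of the air-to-air link -/
  ν : ℝ
  /-- Earth's radius -/
  we : ℝ
  /-- altitude of the aerial transmitter -/
  wr : ℝ
  /-- minimal distance between satellite and aerial transmitter -/
  wmin : ℝ
  /-- upper distance from the aerial transmitter to the truncated cone -/
  h₁ : ℝ
  /-- lower distance from the aerial transmitter to the truncated cone -/
  h₂ : ℝ
  /-- half-beamwidth angle of the cone -/
  φ : ℝ

/-- The ranges of the parameters. -/
structure Params.Valid (p : Params) : Prop where
  χ_mem : p.χ ∈ Set.Ioo (0 : ℝ) 1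
  ρ_mem : p.ρ ∈ Set.Ico (0 : ℝ) 1
  ε_mem : p.ε ∈ Set.Ico (0 : ℝ) 1
  /-- some energy is harvested -/
  harvest : 0 < p.ρ ∨ 0 < p.ε
  μ_mem : p.μ ∈ Set.Ioo (0 : ℝ) 1
  η_pos : 0 < p.η
  Pth_pos : 0 < p.Pth
  varR_pos : 0 < p.varR
  varRB_pos : 0 < p.varRB
  varT_pos : 0 < p.varT
  γ_pos : 0 < p.γ
  b_pos : 0 < p.b
  Om_nonneg : 0 ≤ p.Om
  msr_pos : 1 ≤ p.msr
  K_nonneg : 0 ≤ p.K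
  ν_pos : 0 < p.ν
  we_pos : 0 < p.we
  wr_nonneg : 0 ≤ p.wr
  wmin_pos : 0 < p.wmin
  h₁_pos : 0 < p.h₁
  h₁_lt_h₂ : p.h₁ < p.h₂
  φ_mem : p.φ ∈ Set.Ioo 0 (Real.pi / 2)

namespace Params

variable (p : Params)

/-- `χ_{ρ,ε} = χ (2ρ / (1 - ρ) + ε)` -/
def χρε : ℝ := p.χ * (2 * p.ρ / (1 - p.ρ) + p.ε)

/-- `μ_ε = μ (σ_r² + σ_rb² / (1 - ε))` -/
def με : ℝ := p.μ * (p.varR + p.varRB / (1 - p.ε))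

/-- `μ' = μ / (1 - μ)` -/
def μ' : ℝ := p.μ / (1 - p.μ)

/-- `𝒞 = χ_{ρ,ε} η_s ((1 - μ) - μ γ_A)` -/
def C : ℝ := p.χρε * p.η * ((1 - p.μ) - p.μ * p.γ)

/-- `𝒟 = μ_ε χ_{ρ,ε} γ_A` -/
def D : ℝ := p.με * p.χρε * p.γ

/-- `𝒫_{𝒞,𝒟} = P_th 𝒞 / η_s - 𝒟` -/
def PCD : ℝ := p.Pth * p.C / p.η - p.D

/-- `Θ(γ_A) = (1 + K_rt) σ_t² γ_A` -/
def Θ : ℝ := (1 + p.K) * p.varT * p.γ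

/-- distance of the aerial transmitter from the centre of the Earth -/
def wer : ℝ := p.we + p.wr

/-- maximal distance between the satellite and the aerial transmitter -/
def wmax : ℝ := √(p.wmin ^ 2 + 2 * p.wer * p.wmin)

/-! ### Fading -/

def α : ℝ := (2 * p.b * p.msr / (2 * p.b * p.msr + p.Om)) ^ p.msr / (2 * p.b)

def β : ℝ := 1 / (2 * p.b)

def δ : ℝ := p.Om / ((2 * p.b) * (2 * p.b * p.msr + p.Om))

/-- `β̄_sr = β_sr - δ_sr` -/
def βbar : ℝ := p.β - p.δ

/-- `ζ(k) = (-1)^k (1 - m_sr)_k δ_sr^k / (k!)²`, with the Pochhammer symbol `(·)_k`. -/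
def ζ (k : ℕ) : ℝ :=
  (-1) ^ k * (ascPochhammer ℝ k).eval (1 - (p.msr : ℝ)) * p.δ ^ k / (k.factorial : ℝ) ^ 2

/-- Probability density of the squared modulus of a shadowed-Rician channel. -/
def shadowedRicianPDF (x : ℝ) : ℝ :=
  if 0 ≤ x then p.α * ∑ k ∈ Finset.range p.msr, p.ζ k * x ^ k * Real.exp (-(p.β - p.δ) * x)
  else 0

/-- Probability density of the squared modulus of a Rician channel. -/
def ricianPDF (x : ℝ) : ℝ :=
  if 0 ≤ x then
    (1 + p.K) * Real.exp (-p.K - (1 + p.K) * x) * besselI0 (2 * √(p.K * (1 + p.K) * x))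
  else 0

/-! ### Geometry: the origin is the centre of the Earth, the third axis is vertical at the
aerial transmitter -/

/-- Position of the aerial transmitter. -/
def posR : EuclideanSpace ℝ (Fin 3) := !₂[0, 0, p.wer]

/-- The surface measure of the satellite's sphere, of radius `w_er + w_min`. -/
def orbitArea : Measure (EuclideanSpace ℝ (Fin 3)) :=
  ENNReal.ofReal ((p.wer + p.wmin) ^ 2) •
    ((volume : Measure (EuclideanSpace ℝ (Fin 3))).toSphere).map
      (fun n : Metric.sphere (0 : EuclideanSpace ℝ (Fin 3)) 1 =>
        (p.wer + p.wmin) • (n : EuclideanSpace ℝ (Fin 3)))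

/-- The part of the satellite's sphere that is above the horizontal plane through the aerial
transmitter. -/
def orbitCap : Set (EuclideanSpace ℝ (Fin 3)) :=
  {x | ‖x‖ = p.wer + p.wmin ∧ p.wer ≤ x 2}

/-- The truncated cone below the aerial transmitter. -/
def truncatedCone : Set (EuclideanSpace ℝ (Fin 3)) :=
  {x | p.h₁ ≤ p.wer - x 2 ∧ p.wer - x 2 ≤ p.h₂ ∧
    √(x 0 ^ 2 + x 1 ^ 2) ≤ (p.wer - x 2) * Real.tan p.φ}

end Params

/-! ### The random network -/

section Model

variable {Ω : Type*} [MeasurableSpace Ω] (p : Params) (gsr grt : Ω → ℂ)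
  (S T : Ω → EuclideanSpace ℝ (Fin 3))

/-- The channel coefficients `gsr`, `grt` and the random positions `S`, `T` of the satellite and
the aerial receiver are distributed as in the network with parameters `p`. -/
structure IsNetwork (P : Measure Ω) : Prop where
  measurable_gsr : Measurable gsr
  measurable_grt : Measurable grt
  measurable_S : Measurable S
  measurable_T : Measurable T
  /-- shadowed-Rician fading from the satellite to the aerial transmitter -/
  law_gsr : P.map (fun ω => ‖gsr ω‖ ^ 2) =
    volume.withDensity fun x => ENNReal.ofReal (p.shadowedRicianPDF x)
  /-- Rician fading from the aerial transmitter to the aerial receiver -/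
  law_grt : P.map (fun ω => ‖grt ω‖ ^ 2) =
    volume.withDensity fun x => ENNReal.ofReal (p.ricianPDF x)
  /-- the satellite is uniform on the part of its sphere above the horizon -/
  uniform_S : pdf.IsUniform S p.orbitCap P p.orbitArea
  /-- the aerial receiver is uniform in the truncated cone -/
  uniform_T : pdf.IsUniform T p.truncatedCone P volume
  /-- fading gains and distances are independent -/
  indep : iIndepFun ![fun ω => ‖gsr ω‖ ^ 2, fun ω => dist (S ω) p.posR,
    fun ω => ‖grt ω‖ ^ 2, fun ω => dist p.posR (T ω)] P

/-- `η_s |g_sr|² w_sr⁻²` -/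
def receivedPower (ω : Ω) : ℝ := p.η * ‖gsr ω‖ ^ 2 * dist (S ω) p.posR ^ (-2 : ℤ)

/-- `|g_rt|² w_rt^{-ν_rt}` -/
def linkGain (ω : Ω) : ℝ := ‖grt ω‖ ^ 2 * dist p.posR (T ω) ^ (-p.ν)

/-- The signal-to-noise ratio `Λ_{T,1}` at the aerial receiver, with imperfect interference
cancellation and with the energy harvester in its linear region. -/
def snrLinear (ω : Ω) : ℝ :=
  (1 - p.μ) * p.χρε * receivedPower p gsr S ω * linkGain p grt T ω /
    (p.με * p.χρε * linkGain p grt T ω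
      + p.μ * p.χρε * receivedPower p gsr S ω * linkGain p grt T ω + p.varT)

/-- `P₃(γ_A) = Pr[Λ_{T,1} > γ_A, η_s |g_sr|² w_sr⁻² ≤ P_th]` -/
def P3 (P : Measure Ω) : ℝ :=
  P.real {ω | p.γ < snrLinear p gsr grt S T ω ∧ receivedPower p gsr S ω ≤ p.Pth}

end Model

/-! ### The series -/

namespace Params

variable (p : Params)

/-- `ς₁ = 1 + k₁ + k₂ - n` -/
def ς₁ (n k₁ k₂ : ℕ) : ℤ := 1 + k₁ + k₂ - n

/-- The boundary term
`h^{ν n + j} G^{2,1}_{2,3}[Θ h^ν / 𝒫_{𝒞,𝒟} | 1 - n - j/ν, ς + 1; ς, 0, -n - j/ν]`. -/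
def boundaryTerm (n : ℕ) (ς : ℤ) (j : ℕ) (h : ℝ) : ℂ :=
  ((h ^ (p.ν * n + j) : ℝ) : ℂ) *
    meijerG [1 - n - j / (p.ν : ℂ)] [(ς : ℂ) + 1] [(ς : ℂ), 0] [-(n : ℂ) - j / (p.ν : ℂ)]
      ((p.Θ * h ^ p.ν / p.PCD : ℝ) : ℂ)

/-- The combination of the eight boundary terms. -/
def bracket (n : ℕ) (ς : ℤ) : ℂ :=
  p.boundaryTerm n ς 3 p.h₂
  - p.boundaryTerm n ς 3 p.h₁
  - p.h₁ * p.boundaryTerm n ς 2 (p.h₁ / Real.cos p.φ)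
  + p.h₁ * p.boundaryTerm n ς 2 p.h₁
  - Real.cos p.φ * p.boundaryTerm n ς 3 (p.h₂ / Real.cos p.φ)
  + Real.cos p.φ * p.boundaryTerm n ς 3 (p.h₁ / Real.cos p.φ)
  + p.h₂ * p.boundaryTerm n ς 2 (p.h₂ / Real.cos p.φ)
  - p.h₂ * p.boundaryTerm n ς 2 p.h₂

/-- A term of the series. If `𝒫_{𝒞,𝒟} = 0`, it is given its limit `0` for `𝒫_{𝒞,𝒟} ↓ 0`. -/
def term (k m n k₁ k₂ : ℕ) : ℂ :=
  if p.PCD = 0 then 0 else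
    ((p.ζ k * Real.exp (-p.K) / p.βbar ^ (k + 2)
      * (p.K ^ m * p.Θ ^ n / (m.factorial * n.factorial))
      * (k.choose k₁ : ℝ)
      * ((-1) ^ k₂ / (k₂.factorial : ℝ))
      * (p.PCD ^ ς₁ n k₁ k₂ / p.D ^ (k₁ + k₂ + 2))
      * deltaGamma (k + k₂ + 2) (p.βbar * p.D * p.wmin ^ 2 / p.C)
          (p.βbar * p.D * p.wmax ^ 2 / p.C) : ℝ) : ℂ)
    * p.bracket n (ς₁ n k₁ k₂)

/-- `Ψ̃₁(γ_A)` -/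
def Ψ₁ : ℂ :=
  ((3 * p.C * p.α
      / (p.wer * p.wmin * p.ν * (p.h₂ ^ 3 - p.h₁ ^ 3) * Real.tan p.φ ^ 2) : ℝ) : ℂ)
    * ∑ k ∈ Finset.range p.msr, ∑' m : ℕ, ∑ n ∈ Finset.range (m + 1),
        ∑ k₁ ∈ Finset.range (k + 1), ∑' k₂ : ℕ, p.term k m n k₁ k₂

end Params

end A2A

end

noncomputable section

open Set
open scoped Pointwise

local notation "𝔼³" => EuclideanSpace ℝ (Fin 3)

/-! Put u = w_sr² and let τ = |g_sr|² C / u − D be the excess power. Clearing the positive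
denominator of the signal-to-noise ratio turns the event into σ_t² γ_A < y τ together with τ ≤
P_{C,D}. Since y ≥ 0, it forces 0 < τ ≤ P_{C,D}, which gives the two cases of probability zero.
Otherwise |g_sr|² is replaced by τ through an affine substitution with Jacobian u / C, and
integrating out |g_rt|² leaves the Rician tail at v = Θ w_rt^ν / τ.

The laws of the distances come from spherical coordinates. By Archimedes' theorem the height of the
satellite is uniform, and u is affine in the height, so u is uniform on [w_min², w_max²]
(`map_dist_S`). The density of w_rt is proportional to `coneDensity`, piecewise a combination of w
and w² (`map_dist_T`). Independence then makes P₃ a triple integral over (u, w, τ)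
(`P3_eq_integral`).

The integrand is expanded by three devices. The Rician tail is a Poisson mixture of Poisson
distribution functions (indices m and n ≤ m, from the series of I₀). The power (τ + D)^k is expanded
binomially (k₁), and exp(−β̄ u τ / C) by its power series (k₂). A summable bound, uniform on the
range of integration, justifies termwise integration and gives absolute convergence
(`hasSum_integral_tailExp`). In each term the variables separate: the u-integral is a difference of
incomplete Gamma functions, and an integral over (w, τ) remains.

That last integral is evaluated by Meijer functions. The parameters of G differ by one in two pairs,
so all Gamma factors except Γ(−s) collapse to 1 / ((ς − s)(a + s)) with a = n + j/ν. Mellin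
inversion identifies the resulting contour integral with an integral of w^{νa−1} t^{ς−1} exp(−Θ w^ν
/ t) over a rectangle (0, h] × (0, P_{C,D}] (`mellinBarnes_eq_rect_integral`). Writing the pieces of
`coneDensity` as differences of integrals starting at 0 produces the eight terms of the bracket
(`bracket_eq`). -/

/-! ### Mellin transforms of Laplace-type integrals and a Mellin–Barnes formula. -/

theorem integrable_mellin_kernel {Y : Type*} [MeasurableSpace Y] {m : Measure Y} [SFinite m]
    {g r : Y → ℝ} {s : ℂ} (hs : 0 < s.re) (hg : Measurable g) (hr : Measurable r)
    (hr0 : ∀ᵐ y ∂m, 0 < r y) (hint : Integrable (fun y => g y * r y ^ (-s.re)) m) :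
    Integrable (fun q : ℝ × Y =>
      (q.1 : ℂ) ^ (s - 1) * ((g q.2 * Real.exp (-(r q.2 * q.1)) : ℝ) : ℂ))
      ((volume.restrict (Ioi 0)).prod m) := by
  have hm : Measurable (fun q : ℝ × Y =>
      (q.1 : ℂ) ^ (s - 1) * ((g q.2 * Real.exp (-(r q.2 * q.1)) : ℝ) : ℂ)) := by
    fun_prop
  have hnorm : ∀ y, ∀ z ∈ Ioi (0 : ℝ),
      ‖(z : ℂ) ^ (s - 1) * ((g y * Real.exp (-(r y * z)) : ℝ) : ℂ)‖
        = |g y| * (z ^ (s.re - 1) * Real.exp (-(r y * z))) := by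
    intro y z hz
    rw [norm_mul, Complex.norm_cpow_eq_rpow_re_of_pos hz, Complex.norm_real, norm_mul,
      Real.norm_eq_abs, Real.norm_eq_abs, Real.abs_exp]
    simp
    ring
  have hI : ∀ y, 0 < r y → ∫ z in Ioi (0 : ℝ),
      ‖(z : ℂ) ^ (s - 1) * ((g y * Real.exp (-(r y * z)) : ℝ) : ℂ)‖
        = Real.Gamma s.re * ‖g y * r y ^ (-s.re)‖ := by
    intro y hy
    rw [setIntegral_congr_fun measurableSet_Ioi (hnorm y), integral_const_mul,
      Real.integral_rpow_mul_exp_neg_mul_Ioi hs hy, norm_mul, Real.norm_eq_abs, Real.norm_eq_abs,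
      abs_of_nonneg (Real.rpow_nonneg hy.le _), Real.rpow_neg hy.le, one_div,
      Real.inv_rpow hy.le]
    ring
  rw [integrable_prod_iff' hm.aestronglyMeasurable]
  constructor
  · filter_upwards [hr0] with y hy
    have hmy : AEStronglyMeasurable
        (fun z : ℝ => (z : ℂ) ^ (s - 1) * ((g y * Real.exp (-(r y * z)) : ℝ) : ℂ))
        (volume.restrict (Ioi 0)) := by
      have : Measurable
        (fun z : ℝ => (z : ℂ) ^ (s - 1) * ((g y * Real.exp (-(r y * z)) : ℝ) : ℂ)) := by fun_prop
      exact this.aestronglyMeasurable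
    rw [← integrable_norm_iff hmy]
    have h2 : IntegrableOn (fun z : ℝ => |g y| * (z ^ (s.re - 1) * Real.exp (-(r y * z))))
        (Ioi 0) := by
      refine Integrable.const_mul ?_ _
      have : IntegrableOn (fun z : ℝ => z ^ (s.re - 1) * Real.exp (-(r y * z))) (Ioi 0) := by
        simpa using integrableOn_rpow_mul_exp_neg_mul_rpow (p := 1) (s := s.re - 1) (by linarith)
          (by norm_num) hy
      exact this
    exact (integrableOn_congr_fun (hnorm y) measurableSet_Ioi).2 h2
  · refine (hint.norm.const_mul (Real.Gamma s.re)).congr ?_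
    filter_upwards [hr0] with y hy
    exact (hI y hy).symm

/-- After Fubini the inner integral in z is Euler's integral, ∫ z^{s−1} e^{−rz} dz = Γ(s) r^{−s}. -/
theorem mellin_laplace {Y : Type*} [MeasurableSpace Y] {m : Measure Y} [SFinite m]
    {g r : Y → ℝ} {s : ℂ} (hs : 0 < s.re) (hg : Measurable g) (hr : Measurable r)
    (hr0 : ∀ᵐ y ∂m, 0 < r y) (hint : Integrable (fun y => g y * r y ^ (-s.re)) m) :
    HasMellin (fun z : ℝ => ∫ y, ((g y * Real.exp (-(r y * z)) : ℝ) : ℂ) ∂m) s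
      (Complex.Gamma s * ∫ y, (g y : ℂ) * (r y : ℂ) ^ (-s) ∂m) := by
  have hk := integrable_mellin_kernel hs hg hr hr0 hint
  constructor
  · have := hk.integral_prod_left
    simpa only [MellinConvergent, IntegrableOn, integral_const_mul, smul_eq_mul] using this
  · simp only [mellin, smul_eq_mul, ← integral_const_mul]
    rw [integral_integral_swap hk]
    refine integral_congr_ae ?_
    filter_upwards [hr0] with y hy
    have := Complex.integral_cpow_mul_exp_neg_mul_Ioi hs hy
    have h2 : ∀ z : ℝ, (z : ℂ) ^ (s - 1) * ((g y * Real.exp (-(r y * z)) : ℝ) : ℂ)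
        = (g y : ℂ) * ((z : ℂ) ^ (s - 1) * Complex.exp (-(r y * z))) := by
      intro z; push_cast; ring
    simp only [h2]
    rw [integral_const_mul, this, Complex.cpow_neg, one_div, Complex.inv_cpow]
    · ring
    · rw [Complex.arg_ofReal_of_nonneg hy.le]; exact Real.pi_pos.ne

/-- Raise x/σ ≤ e^{x/σ} to the power σ. This dominates g e^{−rz} by a multiple of g r^{−σ}, whose
integrability is easy to check. -/
theorem exp_neg_le_rpow_neg {σ x : ℝ} (hσ : 0 < σ) (hx : 0 < x) :
    Real.exp (-x) ≤ σ ^ σ * x ^ (-σ) := by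
  have h1 : x / σ ≤ Real.exp (x / σ) := by linarith [Real.add_one_le_exp (x / σ)]
  have h2 := Real.rpow_le_rpow (by positivity) h1 hσ.le
  rw [← Real.exp_mul, div_mul_cancel₀ _ hσ.ne', Real.div_rpow hx.le hσ.le] at h2
  rw [Real.exp_neg, Real.rpow_neg hx.le, ← div_eq_mul_inv, inv_le_comm₀ (Real.exp_pos _)
    (by positivity), inv_div]
  exact h2

theorem continuousAt_laplace {Y : Type*} [MeasurableSpace Y] {m : Measure Y}
    {g r : Y → ℝ} {σ : ℝ} (hs : 0 < σ) (hg : Measurable g) (hr : Measurable r)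
    (hr0 : ∀ᵐ y ∂m, 0 < r y) (hint : Integrable (fun y => g y * r y ^ (-σ)) m)
    {z : ℝ} (hz : 0 < z) :
    ContinuousAt (fun z : ℝ => ∫ y, ((g y * Real.exp (-(r y * z)) : ℝ) : ℂ) ∂m) z := by
  refine continuousAt_of_dominated
    (bound := fun y => (σ ^ σ * (z / 2) ^ (-σ)) * ‖g y * r y ^ (-σ)‖) ?_ ?_ ?_ ?_
  · refine Filter.Eventually.of_forall fun x => ?_
    have : Measurable (fun y => ((g y * Real.exp (-(r y * x)) : ℝ) : ℂ)) := by fun_prop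
    exact this.aestronglyMeasurable
  -- Points near z stay above z/2, so one bound serves the whole neighbourhood.
  · filter_upwards [lt_mem_nhds (half_lt_self hz)] with x hx
    filter_upwards [hr0] with y hy
    have h1 : Real.exp (-(r y * x)) ≤ Real.exp (-(r y * (z / 2))) := by
      apply Real.exp_le_exp.2
      have := mul_le_mul_of_nonneg_left hx.le hy.le
      linarith
    have h2 := h1.trans (exp_neg_le_rpow_neg hs (by positivity : 0 < r y * (z / 2)))
    rw [Real.mul_rpow hy.le (by positivity)] at h2
    rw [Complex.norm_real, norm_mul, norm_mul, Real.norm_eq_abs (Real.exp _), Real.abs_exp,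
      Real.norm_eq_abs (r y ^ _), abs_of_nonneg (Real.rpow_nonneg hy.le _)]
    calc _ ≤ ‖g y‖ * (σ ^ σ * (r y ^ (-σ) * (z / 2) ^ (-σ))) := by gcongr
      _ = _ := by ring
  · exact hint.norm.const_mul _
  · refine Filter.Eventually.of_forall fun y => ?_
    fun_prop

theorem norm_Gamma_le_Gamma_re {s : ℂ} (hs : 0 < s.re) : ‖Complex.Gamma s‖ ≤ Real.Gamma s.re := by
  rw [Complex.Gamma_eq_integral hs, Real.Gamma_eq_integral hs, Complex.GammaIntegral]
  refine (norm_integral_le_integral_norm _).trans (le_of_eq ?_)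
  refine setIntegral_congr_fun measurableSet_Ioi fun x hx => ?_
  rw [norm_mul, Complex.norm_real, Complex.norm_cpow_eq_rpow_re_of_pos hx, Real.norm_eq_abs,
    Real.abs_exp]
  simp

theorem ofReal_cpow_eq_exp {x : ℝ} (hx : 0 < x) (s : ℂ) :
    (x : ℂ) ^ s = Complex.exp (Real.log x * s) := by
  rw [Complex.cpow_def_of_ne_zero (by exact_mod_cast hx.ne'), Complex.ofReal_log hx.le]

theorem setIntegral_Ioc_cpow {h : ℝ} (hh : 0 < h) {r : ℂ} (hr : 0 < r.re) :
    ∫ x in Ioc 0 h, (x : ℂ) ^ (r - 1) = (h : ℂ) ^ r / r := by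
  have hr0 : r ≠ 0 := by rintro rfl; simp at hr
  rw [← intervalIntegral.integral_of_le hh.le, integral_cpow (by left; simp; linarith)]
  simp [hr0]

theorem integrableOn_Ioc_rpow {h r : ℝ} (hh : 0 < h) (hr : 0 < r) :
    IntegrableOn (fun x : ℝ => x ^ (r - 1)) (Ioc 0 h) :=
  (intervalIntegrable_iff_integrableOn_Ioc_of_le hh.le).1
    (intervalIntegral.intervalIntegrable_rpow' (by linarith))

theorem continuous_Gamma_vertical {σ : ℝ} (hσ : 0 < σ) :
    Continuous fun t : ℝ => Complex.Gamma (σ + t * Complex.I) := by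
  rw [continuous_iff_continuousAt]
  intro t
  have h1 : ContinuousAt Complex.Gamma (σ + t * Complex.I) := by
    refine (Complex.differentiableAt_Gamma _ fun m hm => ?_).continuousAt
    have := congrArg Complex.re hm
    simp at this
    have h2 : (0 : ℝ) ≤ m := by positivity
    linarith
  exact ContinuousAt.comp (f := fun t : ℝ => (σ + t * Complex.I : ℂ)) h1 (by fun_prop)

/-- Both factors are at least d √(1 + t²) in modulus. This quadratic decay already makes the Mellin
inversion integral converge, so boundedness of Γ on the line suffices and no Stirling estimate
enters. -/
theorem integrable_inv_mul_vertical {A B : ℝ} (hA : 0 < A) (hB : 0 < B) :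
    Integrable fun t : ℝ => ‖((A + t * Complex.I) * (B + t * Complex.I) : ℂ)⁻¹‖ := by
  set d := min 1 (min A B) with hd
  have hd0 : 0 < d := by positivity
  have hd1 : d ≤ 1 := min_le_left _ _
  have hdA : d ≤ A := (min_le_right _ _).trans (min_le_left _ _)
  have hdB : d ≤ B := (min_le_right _ _).trans (min_le_right _ _)
  have key : ∀ X : ℝ, d ≤ X → ∀ t : ℝ, d * √(1 + t ^ 2) ≤ ‖(X + t * Complex.I : ℂ)‖ := by
    intro X hX t
    rw [Complex.norm_add_mul_I]
    apply Real.le_sqrt_of_sq_le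
    rw [mul_pow, Real.sq_sqrt (by positivity)]
    have h1 : d ^ 2 ≤ X ^ 2 := by gcongr
    have h2 : d ^ 2 * t ^ 2 ≤ 1 * t ^ 2 := by
      gcongr; nlinarith
    nlinarith
  refine Integrable.mono' (integrable_inv_one_add_sq.const_mul (d ^ 2)⁻¹) ?_ ?_
  · have : Measurable fun t : ℝ => ‖((A + t * Complex.I) * (B + t * Complex.I) : ℂ)⁻¹‖ := by
      fun_prop
    exact this.aestronglyMeasurable
  · refine Filter.Eventually.of_forall fun t => ?_
    rw [norm_norm, norm_inv, norm_mul, ← mul_inv]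
    refine inv_anti₀ (by positivity) ?_
    calc d ^ 2 * (1 + t ^ 2) = (d * √(1 + t ^ 2)) * (d * √(1 + t ^ 2)) := by
          rw [mul_mul_mul_comm, Real.mul_self_sqrt (by positivity)]; ring
      _ ≤ _ := mul_le_mul (key A hdA t) (key B hdB t) (by positivity) (by positivity)

/-- The measure on the rectangle `(0, h] × (0, P]`. -/
abbrev rectMeasure (h P : ℝ) : Measure (ℝ × ℝ) :=
  (volume.restrict (Ioc 0 h)).prod (volume.restrict (Ioc 0 P))

theorem ae_rectMeasure (h P : ℝ) : ∀ᵐ q ∂(rectMeasure h P), 0 < q.1 ∧ 0 < q.2 := by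
  rw [rectMeasure, Measure.prod_restrict]
  filter_upwards [ae_restrict_mem (measurableSet_Ioc.prod measurableSet_Ioc)] with q hq
  exact ⟨hq.1.1, hq.2.1⟩

/-- The variables separate into w^{ν(a−σ)−1} and t^{b+σ−1}; the two strict inequalities on σ are
integrability at 0. -/
theorem integrable_rect_rpow {a b ν σ h P : ℝ} (hν : 0 < ν) (hh : 0 < h)
    (hP : 0 < P) (hσa : σ < a) (hσb : -b < σ) :
    Integrable (fun q : ℝ × ℝ => (ν * q.1 ^ (ν * a - 1) * q.2 ^ (b - 1)) *
      (q.1 ^ ν / q.2) ^ (-σ)) (rectMeasure h P) := by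
  have h1 := ((integrableOn_Ioc_rpow hh (mul_pos hν (sub_pos.2 hσa))).const_mul ν).mul_prod
    (integrableOn_Ioc_rpow hP (by linarith : 0 < b + σ))
  refine h1.congr ?_
  filter_upwards [ae_rectMeasure h P] with q hq
  obtain ⟨hw, ht⟩ := hq
  rw [Real.div_rpow (by positivity) ht.le, ← Real.rpow_mul hw.le, Real.rpow_neg ht.le (σ),
    div_inv_eq_mul, show ν * (a - σ) - 1 = (ν * a - 1) + ν * -σ by ring,
    show b + σ - 1 = (b - 1) + σ by ring, Real.rpow_add hw, Real.rpow_add ht]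
  ring

theorem integral_rect_cpow {a b ν h P : ℝ} {s : ℂ} (hν : 0 < ν) (hh : 0 < h)
    (hP : 0 < P) (hσa : s.re < a) (hσb : -b < s.re) :
    ∫ q : ℝ × ℝ, ((ν * q.1 ^ (ν * a - 1) * q.2 ^ (b - 1) : ℝ) : ℂ) *
      ((q.1 ^ ν / q.2 : ℝ) : ℂ) ^ (-s) ∂(rectMeasure h P) =
      (h : ℂ) ^ (ν * (a - s)) * (P : ℂ) ^ (b + s) * ((a - s) * (b + s))⁻¹ := by
  have h1 : ∫ q : ℝ × ℝ, (ν * (q.1 : ℂ) ^ (ν * (a - s) - 1)) * (q.2 : ℂ) ^ (b + s - 1)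
      ∂(rectMeasure h P) =
      (h : ℂ) ^ (ν * (a - s)) * (P : ℂ) ^ (b + s) * ((a - s) * (b + s))⁻¹ := by
    rw [integral_prod_mul (fun w : ℝ => ν * (w : ℂ) ^ (ν * (a - s) - 1))
      (fun t : ℝ => (t : ℂ) ^ (b + s - 1)), integral_const_mul, setIntegral_Ioc_cpow hh,
      setIntegral_Ioc_cpow hP]
    · have hν' : (ν : ℂ) ≠ 0 := by exact_mod_cast hν.ne'
      rw [mul_inv, div_eq_mul_inv, div_eq_mul_inv, mul_inv]
      field_simp
    · simp; linarith
    · simp; nlinarith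
  rw [← h1]
  refine integral_congr_ae ?_
  filter_upwards [ae_rectMeasure h P] with q hq
  obtain ⟨hw, ht⟩ := hq
  have hw' : (q.1 : ℂ) ≠ 0 := by exact_mod_cast hw.ne'
  have ht' : (q.2 : ℂ) ≠ 0 := by exact_mod_cast ht.ne'
  have e1 : ((q.1 ^ ν / q.2 : ℝ) : ℂ) ^ (-s) = (q.1 : ℂ) ^ (ν * -s) * (q.2 : ℂ) ^ s := by
    rw [ofReal_cpow_eq_exp (by positivity), ofReal_cpow_eq_exp hw, ofReal_cpow_eq_exp ht,
      Real.log_div (by positivity) ht.ne', Real.log_rpow hw, ← Complex.exp_add]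
    push_cast
    congr 1
    ring
  rw [e1]
  push_cast
  rw [Complex.ofReal_cpow hw.le, Complex.ofReal_cpow ht.le,
    show (ν * (a - s) - 1 : ℂ) = ((ν * a - 1 : ℝ) : ℂ) + ν * -s by push_cast; ring,
    show (b + s - 1 : ℂ) = ((b - 1 : ℝ) : ℂ) + s by push_cast; ring, Complex.cpow_add _ _ hw',
    Complex.cpow_add _ _ ht']
  ring


/-- As a function of z, the right side is a Laplace-type integral with rate w^ν / t. Its Mellin
transform is Γ(s) h^{ν(a−s)} P^{b+s} / ((a − s)(b + s)), and Mellin inversion along Re s = −c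
recovers it. The conditions on c say that −c lies in the strip max(0, −b) < Re s < a. -/
theorem mellinBarnes_eq_rect_integral {a b ν h P z c : ℝ} (hν : 0 < ν) (hh : 0 < h)
    (hP : 0 < P) (hz : 0 < z) (hca : -a < c) (hc0 : c < 0) (hcb : c < b) :
    (h : ℂ) ^ ((ν * a : ℝ) : ℂ) * (P : ℂ) ^ (b : ℂ) * ((1 / (2 * Real.pi) : ℂ) *
      ∫ t : ℝ, Complex.Gamma (-(c + t * Complex.I)) /
        ((b - (c + t * Complex.I)) * (a + (c + t * Complex.I))) *
          ((z * h ^ ν / P : ℝ) : ℂ) ^ (c + t * Complex.I : ℂ)) =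
    ∫ q : ℝ × ℝ, ((ν * q.1 ^ (ν * a - 1) * q.2 ^ (b - 1) *
      Real.exp (-(q.1 ^ ν / q.2 * z)) : ℝ) : ℂ) ∂(rectMeasure h P) := by
  set g : ℝ × ℝ → ℝ := fun q => ν * q.1 ^ (ν * a - 1) * q.2 ^ (b - 1) with hg
  set r : ℝ × ℝ → ℝ := fun q => q.1 ^ ν / q.2 with hr
  have hgm : Measurable g := by fun_prop
  have hrm : Measurable r := by fun_prop
  have hr0 : ∀ᵐ q ∂(rectMeasure h P), 0 < r q := by
    filter_upwards [ae_rectMeasure h P] with q hq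
    have := hq.1
    have := hq.2
    positivity
  have hint := integrable_rect_rpow (σ := -c) hν hh hP (by linarith : -c < a) (by linarith : -b < -c)
  set f : ℝ → ℂ := fun z => ∫ q, ((g q * Real.exp (-(r q * z)) : ℝ) : ℂ) ∂(rectMeasure h P) with hf
  have hmel : ∀ s : ℂ, s.re = -c → HasMellin f s (Complex.Gamma s *
      ((h : ℂ) ^ (ν * (a - s)) * (P : ℂ) ^ (b + s) * ((a - s) * (b + s))⁻¹)) := by
    intro s hs
    rw [← integral_rect_cpow hν hh hP (by rw [hs]; linarith) (by rw [hs]; linarith)]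
    exact mellin_laplace (by rw [hs]; linarith) hgm hrm hr0 (by rw [hs]; exact hint)
  have hre : ∀ t : ℝ, (((-c : ℝ) : ℂ) + t * Complex.I).re = -c := by intro t; simp
  have hvert : Complex.VerticalIntegrable (mellin f) (-c) := by
    have h1 : Integrable fun t : ℝ => Real.Gamma (-c) * h ^ (ν * (a + c)) * P ^ (b - c) *
        ‖(((a + c : ℝ) - t * Complex.I) * ((b - c : ℝ) + t * Complex.I) : ℂ)⁻¹‖ := by
      refine Integrable.const_mul ?_ _
      refine (integrable_inv_mul_vertical (by linarith : 0 < a + c)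
        (by linarith : 0 < b - c)).congr ?_
      refine Filter.Eventually.of_forall fun t => ?_
      simp only [norm_inv, norm_mul]
      congr 2
      rw [sub_eq_add_neg, ← neg_mul, ← Complex.ofReal_neg, Complex.norm_add_mul_I,
        Complex.norm_add_mul_I, neg_sq]
    refine Integrable.mono' h1 ?_ ?_
    · simp only [(hmel _ (hre _)).2]
      have hG : Measurable fun t : ℝ => Complex.Gamma (((-c : ℝ) : ℂ) + t * Complex.I) :=
        (continuous_Gamma_vertical (by linarith : 0 < -c)).measurable
      have : Measurable fun t : ℝ => Complex.Gamma (((-c : ℝ) : ℂ) + t * Complex.I) *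
        ((h : ℂ) ^ (ν * (a - (((-c : ℝ) : ℂ) + t * Complex.I))) *
          (P : ℂ) ^ (b + (((-c : ℝ) : ℂ) + t * Complex.I)) *
          ((a - (((-c : ℝ) : ℂ) + t * Complex.I)) * (b + (((-c : ℝ) : ℂ) + t * Complex.I)))⁻¹) := by
        fun_prop
      exact this.aestronglyMeasurable
    · refine Filter.Eventually.of_forall fun t => ?_
      rw [(hmel _ (hre _)).2, norm_mul, norm_mul, norm_mul,
        Complex.norm_cpow_eq_rpow_re_of_pos hh, Complex.norm_cpow_eq_rpow_re_of_pos hP]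
      have hGn := norm_Gamma_le_Gamma_re (s := ((-c : ℝ) : ℂ) + t * Complex.I)
        (by rw [hre]; linarith)
      rw [hre] at hGn
      have e1 : ((ν : ℂ) * (a - (((-c : ℝ) : ℂ) + t * Complex.I))).re = ν * (a + c) := by simp
      have e2 : ((b : ℂ) + (((-c : ℝ) : ℂ) + t * Complex.I)).re = b - c := by simp; ring
      have e3 : ((a : ℂ) - (((-c : ℝ) : ℂ) + t * Complex.I)) = ((a + c : ℝ) - t * Complex.I) := by
        push_cast; ring
      have e4 : ((b : ℂ) + (((-c : ℝ) : ℂ) + t * Complex.I)) = ((b - c : ℝ) + t * Complex.I) := by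
        push_cast; ring
      rw [e1, e2, e3, e4, mul_assoc (Real.Gamma _), mul_assoc (Real.Gamma _)]
      gcongr
  have hinv := mellinInv_mellin_eq (-c) f hz (hmel _ (by simp)).1 hvert
    (continuousAt_laplace (by linarith : 0 < -c) hgm hrm hr0 hint hz)
  have hR : (∫ q : ℝ × ℝ, ((ν * q.1 ^ (ν * a - 1) * q.2 ^ (b - 1) *
      Real.exp (-(q.1 ^ ν / q.2 * z)) : ℝ) : ℂ) ∂(rectMeasure h P)) = f z := rfl
  -- Mellin inversion carries z^{−s} and the Mellin–Barnes integral z^s; reflecting the line by t ↦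
  -- −t matches them.
  rw [hR, ← hinv, mellinInv, ← integral_neg_eq_self, ← integral_const_mul, ← integral_const_mul,
    ← integral_smul]
  refine integral_congr_ae (Filter.Eventually.of_forall fun t => ?_)
  simp only
  rw [(hmel _ (hre _)).2]
  set s : ℂ := c + ((-t : ℝ) : ℂ) * Complex.I with hs
  have e1 : ((-c : ℝ) : ℂ) + t * Complex.I = -s := by rw [hs]; push_cast; ring
  rw [e1, neg_neg]
  have e2 : ((z * h ^ ν / P : ℝ) : ℂ) ^ s * ((h : ℂ) ^ ((ν * a : ℝ) : ℂ) * (P : ℂ) ^ (b : ℂ))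
      = (z : ℂ) ^ s * ((h : ℂ) ^ (ν * (a - -s)) * (P : ℂ) ^ (b + -s)) := by
    rw [ofReal_cpow_eq_exp (by positivity), ofReal_cpow_eq_exp hh, ofReal_cpow_eq_exp hP,
      ofReal_cpow_eq_exp hh, ofReal_cpow_eq_exp hP, ofReal_cpow_eq_exp hz,
      Real.log_div (by positivity) hP.ne', Real.log_mul hz.ne' (by positivity), Real.log_rpow hh,
      ← Complex.exp_add, ← Complex.exp_add, ← Complex.exp_add, ← Complex.exp_add]
    push_cast
    congr 1
    ring
  rw [Complex.real_smul, smul_eq_mul]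
  push_cast
  push_cast at e2
  linear_combination (1 / (2 * Real.pi) * Complex.Gamma (-s) * ((b - s) * (a + s))⁻¹) * e2

/-! ### Integration against the cone density. -/

/-- Up to a constant, the density of the distance between the apex and a uniform point of a
truncated cone between the depths `h₁` and `h₂` whose half-angle has cosine `c`. -/
def coneDensity (h₁ h₂ c w : ℝ) : ℝ := min (w ^ 2) (h₂ * w) - max (c * w ^ 2) (h₁ * w)

theorem continuous_coneDensity (h₁ h₂ c : ℝ) : Continuous (coneDensity h₁ h₂ c) := by
  unfold coneDensity; fun_prop

theorem coneDensity_nonneg {h₁ h₂ c w : ℝ} (h1 : 0 < h₁) (h12 : h₁ ≤ h₂) (c0 : 0 < c) (c1 : c ≤ 1)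
    (hw : w ∈ Icc h₁ (h₂ / c)) : 0 ≤ coneDensity h₁ h₂ c w := by
  obtain ⟨hw1, hw2⟩ := hw
  have hw0 : 0 < w := h1.trans_le hw1
  rw [le_div_iff₀ c0] at hw2
  rw [coneDensity, sub_nonneg]
  refine le_min (max_le ?_ ?_) (max_le ?_ ?_) <;> nlinarith [sq_nonneg w]

theorem coneDensity_nonpos {h₁ h₂ c w : ℝ} (c0 : 0 < c)
    (hw0 : 0 < w) (hw : w ∉ Icc h₁ (h₂ / c)) : coneDensity h₁ h₂ c w ≤ 0 := by
  rw [coneDensity, sub_nonpos]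
  by_cases h : h₁ ≤ w
  · have h2 : h₂ / c < w := lt_of_not_ge fun h' => hw ⟨h, h'⟩
    rw [div_lt_iff₀ c0] at h2
    refine (min_le_right _ _).trans (le_trans ?_ (le_max_left _ _))
    nlinarith
  · refine (min_le_left _ _).trans (le_trans ?_ (le_max_right _ _))
    nlinarith

/-- The minimum changes branch at h₂ and the maximum at h₁/c. They are split separately, so the
order of these two points does not matter. Each of the four pieces is a difference of two integrals
starting at 0, whence eight terms. -/
theorem intervalIntegral_coneDensity_mul {h₁ h₂ c : ℝ} {G : ℝ → ℝ} (h1 : 0 < h₁) (h12 : h₁ < h₂)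
    (c0 : 0 < c) (c1 : c ≤ 1)
    (hi3 : ∀ h, 0 < h → IntervalIntegrable (fun w => w ^ 2 * G w) volume 0 h)
    (hi2 : ∀ h, 0 < h → IntervalIntegrable (fun w => w * G w) volume 0 h) :
    ∫ w in h₁..(h₂ / c), coneDensity h₁ h₂ c w * G w =
      (∫ w in 0..h₂, w ^ 2 * G w) - (∫ w in 0..h₁, w ^ 2 * G w)
      - h₁ * (∫ w in 0..(h₁ / c), w * G w) + h₁ * (∫ w in 0..h₁, w * G w)
      - c * (∫ w in 0..(h₂ / c), w ^ 2 * G w) + c * (∫ w in 0..(h₁ / c), w ^ 2 * G w)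
      + h₂ * (∫ w in 0..(h₂ / c), w * G w) - h₂ * (∫ w in 0..h₂, w * G w) := by
  have h2 : 0 < h₂ := h1.trans h12
  have h1c : h₁ ≤ h₁ / c := by rw [le_div_iff₀ c0]; nlinarith
  have h2c : h₂ ≤ h₂ / c := by rw [le_div_iff₀ c0]; nlinarith
  have h12c : h₁ / c ≤ h₂ / c := by gcongr
  have p1c : 0 < h₁ / c := by positivity
  have p2c : 0 < h₂ / c := by positivity
  have hs3 : ∀ x y, 0 < x → 0 < y → IntervalIntegrable (fun w => w ^ 2 * G w) volume x y :=
    fun x y hx hy => (hi3 x hx).symm.trans (hi3 y hy)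
  have hs2 : ∀ x y, 0 < x → 0 < y → IntervalIntegrable (fun w => w * G w) volume x y :=
    fun x y hx hy => (hi2 x hx).symm.trans (hi2 y hy)
  have hd3 : ∀ x y, 0 < x → 0 < y → (∫ w in x..y, w ^ 2 * G w) =
      (∫ w in 0..y, w ^ 2 * G w) - ∫ w in 0..x, w ^ 2 * G w := fun x y hx hy =>
    (intervalIntegral.integral_interval_sub_left (hi3 y hy) (hi3 x hx)).symm
  have hd2 : ∀ x y, 0 < x → 0 < y → (∫ w in x..y, w * G w) =
      (∫ w in 0..y, w * G w) - ∫ w in 0..x, w * G w := fun x y hx hy =>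
    (intervalIntegral.integral_interval_sub_left (hi2 y hy) (hi2 x hx)).symm
  have split : ∀ (f g k : ℝ → ℝ) (b : ℝ), h₁ ≤ b → b ≤ h₂ / c →
      IntervalIntegrable g volume h₁ b → IntervalIntegrable k volume b (h₂ / c) →
      (∀ w ∈ Icc h₁ b, f w = g w) → (∀ w ∈ Icc b (h₂ / c), f w = k w) →
      IntervalIntegrable f volume h₁ (h₂ / c) ∧ ∫ w in h₁..(h₂ / c), f w =
        (∫ w in h₁..b, g w) + ∫ w in b..(h₂ / c), k w := by
    intro f g k b hb1 hb2 hg hk hfg hfk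
    have e1 : EqOn f g (uIcc h₁ b) := by rw [uIcc_of_le hb1]; exact hfg
    have e2 : EqOn f k (uIcc b (h₂ / c)) := by rw [uIcc_of_le hb2]; exact hfk
    have i1 : IntervalIntegrable f volume h₁ b :=
      hg.congr fun w hw => (e1 (uIoc_subset_uIcc hw)).symm
    have i2 : IntervalIntegrable f volume b (h₂ / c) :=
      hk.congr fun w hw => (e2 (uIoc_subset_uIcc hw)).symm
    refine ⟨i1.trans i2, ?_⟩
    rw [← intervalIntegral.integral_add_adjacent_intervals i1 i2,
      intervalIntegral.integral_congr e1, intervalIntegral.integral_congr e2]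
  have hmin := split (fun w => min (w ^ 2) (h₂ * w) * G w) (fun w => w ^ 2 * G w)
    (fun w => h₂ * (w * G w)) h₂ h12.le h2c (hs3 _ _ h1 h2) ((hs2 _ _ h2 p2c).const_mul _)
    (fun w hw => by
      have : w ^ 2 ≤ h₂ * w := by nlinarith [hw.1, hw.2]
      simp only [min_eq_left this])
    (fun w hw => by
      have : h₂ * w ≤ w ^ 2 := by nlinarith [hw.1, hw.2]
      simp only [min_eq_right this]; ring)
  have hmax := split (fun w => max (c * w ^ 2) (h₁ * w) * G w) (fun w => h₁ * (w * G w))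
    (fun w => c * (w ^ 2 * G w)) (h₁ / c) h1c h12c ((hs2 _ _ h1 p1c).const_mul _)
    ((hs3 _ _ p1c p2c).const_mul _)
    (fun w hw => by
      have hw2 := hw.2
      rw [le_div_iff₀ c0] at hw2
      have : c * w ^ 2 ≤ h₁ * w := by nlinarith [hw.1]
      simp only [max_eq_right this]; ring)
    (fun w hw => by
      have hw2 := hw.1
      rw [div_le_iff₀ c0] at hw2
      have : h₁ * w ≤ c * w ^ 2 := by nlinarith [hw.1]
      simp only [max_eq_left this]; ring)
  simp only [coneDensity, sub_mul]
  rw [intervalIntegral.integral_sub hmin.1 hmax.1, hmin.2, hmax.2]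
  simp only [intervalIntegral.integral_const_mul]
  rw [hd3 _ _ h1 h2, hd2 _ _ h2 p2c, hd2 _ _ h1 p1c, hd3 _ _ p1c p2c]
  ring

/-- The normalising constant of the density of w_rt: the same eight terms with G = 1. -/
theorem intervalIntegral_coneDensity {h₁ h₂ φ : ℝ} (h1 : 0 < h₁) (h12 : h₁ < h₂)
    (c0 : 0 < Real.cos φ) :
    ∫ w in h₁..(h₂ / Real.cos φ), coneDensity h₁ h₂ (Real.cos φ) w =
      Real.tan φ ^ 2 * (h₂ ^ 3 - h₁ ^ 3) / 6 := by
  have h := intervalIntegral_coneDensity_mul (G := fun _ => 1) h1 h12 c0 (Real.cos_le_one φ)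
    (fun h _ => Continuous.intervalIntegrable (by fun_prop) _ _)
    (fun h _ => Continuous.intervalIntegrable (by fun_prop) _ _)
  simp only [mul_one] at h
  rw [h]
  simp only [integral_pow, integral_id]
  have ht : Real.tan φ ^ 2 = 1 / Real.cos φ ^ 2 - 1 := by
    rw [Real.tan_eq_sin_div_cos, div_pow, Real.sin_sq]; field_simp
  rw [ht]
  generalize Real.cos φ = c at c0
  norm_num
  field_simp
  ring

/-! ### Meijer boundary terms as integrals. -/

/-- The exponent b may be negative, and then t^{b−1} alone is not integrable at 0; the factor
exp(−w^ν z / t) compensates through `exp_neg_le_rpow_neg` with some σ between max(0, −b) and a. -/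
theorem integrable_rect_exp {a b ν h P z : ℝ} (hν : 0 < ν) (hh : 0 < h)
    (hP : 0 < P) (hz : 0 < z) (ha : 0 < a) (hab : -b < a) :
    Integrable (fun q : ℝ × ℝ => q.1 ^ (ν * a - 1) * q.2 ^ (b - 1) *
      Real.exp (-(q.1 ^ ν / q.2 * z))) (rectMeasure h P) := by
  obtain ⟨σ, h1, h2⟩ := exists_between (max_lt ha hab)
  have hσ0 : 0 < σ := (le_max_left _ _).trans_lt h1
  have hσb : -b < σ := (le_max_right _ _).trans_lt h1
  have hint := (integrable_rect_rpow hν hh hP h2 hσb).const_mul (ν⁻¹ * (σ ^ σ * z ^ (-σ)))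
  refine Integrable.mono' hint ?_ ?_
  · have : Measurable (fun q : ℝ × ℝ => q.1 ^ (ν * a - 1) * q.2 ^ (b - 1) *
      Real.exp (-(q.1 ^ ν / q.2 * z))) := by fun_prop
    exact this.aestronglyMeasurable
  · filter_upwards [ae_rectMeasure h P] with q hq
    obtain ⟨hw, ht⟩ := hq
    rw [Real.norm_of_nonneg (by positivity)]
    have := exp_neg_le_rpow_neg hσ0 (by positivity : 0 < q.1 ^ ν / q.2 * z)
    rw [Real.mul_rpow (by positivity) hz.le] at this
    calc _ ≤ q.1 ^ (ν * a - 1) * q.2 ^ (b - 1) *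
        (σ ^ σ * ((q.1 ^ ν / q.2) ^ (-σ) * z ^ (-σ))) := by gcongr
      _ = _ := by field_simp

namespace A2A.Params

/-- The quotients Γ(ς − s)/Γ(ς + 1 − s) and Γ(a + s)/Γ(a + s + 1) are 1/(ς − s) and 1/(a + s). The
abscissa is whichever one the definition selects; only its position relative to the poles is used
later. -/
theorem meijerG_eq {ς : ℤ} {a z : ℝ} (ha : 0 < a) (hς : -a < ς) :
    ∃ c : ℝ, -a < c ∧ c < 0 ∧ c < ς ∧
      meijerG [1 - (a : ℂ)] [(ς : ℂ) + 1] [(ς : ℂ), 0] [-(a : ℂ)] (z : ℂ) =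
      (1 / (2 * Real.pi) : ℂ) * ∫ t : ℝ, Complex.Gamma (-(c + t * Complex.I)) /
        ((((ς : ℝ) : ℂ) - (c + t * Complex.I)) * (a + (c + t * Complex.I))) *
          (z : ℂ) ^ (c + t * Complex.I : ℂ) := by
  have hex : ∃ c : ℝ, (∀ a' ∈ [1 - (a : ℂ)], a'.re - 1 < c) ∧ (∀ b ∈ [(ς : ℂ), 0], c < b.re) := by
    obtain ⟨c, h1, h2⟩ := exists_between (lt_min hς (neg_neg_of_pos ha))
    refine ⟨c, ?_, ?_⟩
    · simp; exact h1
    · simp; exact lt_min_iff.1 h2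
  have hc1 := hex.choose_spec.1
  have hc2 := hex.choose_spec.2
  refine ⟨hex.choose, ?_, ?_, ?_, ?_⟩
  · simpa using hc1 _ (List.mem_singleton_self _)
  · simpa using hc2 0 (by simp)
  · simpa using hc2 ς (by simp)
  · rw [meijerG, dif_pos hex]
    congr 1
    refine integral_congr_ae (Filter.Eventually.of_forall fun t => ?_)
    have k1 : -a < hex.choose := by simpa using hc1 _ (List.mem_singleton_self _)
    have k2 : hex.choose < ς := by simpa using hc2 ς (by simp)
    generalize hex.choose = c at k1 k2
    beta_reduce
    set s : ℂ := c + t * Complex.I with hs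
    have hre : s.re = c := by simp [hs]
    have g1 : 0 < ((ς : ℂ) - s).re := by rw [Complex.sub_re, hre]; simpa using k2
    have g2 : 0 < ((a : ℂ) + s).re := by rw [Complex.add_re, hre]; simp; linarith
    have n1 : ((ς : ℂ) - s) ≠ 0 := by intro h; rw [h] at g1; simp at g1
    have n2 : ((a : ℂ) + s) ≠ 0 := by intro h; rw [h] at g2; simp at g2
    have G1 := Complex.Gamma_ne_zero_of_re_pos g1
    have G2 := Complex.Gamma_ne_zero_of_re_pos g2
    simp only [meijerIntegrand, List.map_cons, List.map_nil, List.prod_cons, List.prod_nil, mul_one]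
    rw [show (1 - (1 - (a : ℂ)) + s) = a + s by ring,
      show (1 - -(a : ℂ) + s) = (a + s) + 1 by ring,
      show ((ς : ℂ) + 1 - s) = (ς - s) + 1 by ring, Complex.Gamma_add_one _ n1,
      Complex.Gamma_add_one _ n2, zero_sub]
    push_cast
    field_simp

variable {p : Params}

theorem boundaryTerm_eq (hν : 0 < p.ν) (hΘ : 0 < p.Θ) (hP : 0 < p.PCD) {n : ℕ} {ς : ℤ}
    (hς : 1 - (n : ℤ) ≤ ς) {j : ℕ} (hj : 1 ≤ j) {h : ℝ} (hh : 0 < h) :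
    ((p.PCD ^ ς : ℝ) : ℂ) * p.boundaryTerm n ς j h =
      ((p.ν * ∫ w in 0..h, w ^ (p.ν * n + j - 1) *
        ∫ t in Ioc 0 p.PCD, t ^ ((ς : ℝ) - 1) * Real.exp (-(w ^ p.ν / t * p.Θ)) : ℝ) : ℂ) := by
  set a : ℝ := n + j / p.ν with ha
  have hj' : (0 : ℝ) < j := by exact_mod_cast hj
  have ha0 : 0 < a := by positivity
  -- Together with 1 − n ≤ ς this gives −a < ς, so a separating vertical line exists.
  have hna : (n : ℝ) ≤ a := by rw [ha]; have : 0 < (j : ℝ) / p.ν := by positivity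
                               linarith
  have hς' : (1 : ℝ) - n ≤ ς := by exact_mod_cast hς
  have hνa : p.ν * a = p.ν * n + j := by rw [ha]; field_simp
  obtain ⟨c, hc1, hc2, hc3, hG⟩ := meijerG_eq (z := p.Θ * h ^ p.ν / p.PCD) ha0
    (by linarith : -a < ς)
  have hmb := mellinBarnes_eq_rect_integral hν hh hP hΘ hc1 hc2 hc3
  have e1 : (1 - n - j / (p.ν : ℂ)) = 1 - (a : ℂ) := by rw [ha]; push_cast; ring
  have e2 : (-(n : ℂ) - j / (p.ν : ℂ)) = -(a : ℂ) := by rw [ha]; push_cast; ring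
  rw [boundaryTerm, e1, e2, hG]
  have e3 : ((h ^ (p.ν * n + j) : ℝ) : ℂ) = (h : ℂ) ^ ((p.ν * a : ℝ) : ℂ) := by
    rw [hνa, Complex.ofReal_cpow hh.le]
  -- The power of P_{C,D} standing in the series is the factor P^b required by the Mellin–Barnes
  -- formula with b = ς.
  have e4 : ((p.PCD ^ ς : ℝ) : ℂ) = (p.PCD : ℂ) ^ ((ς : ℝ) : ℂ) := by
    rw [← Complex.ofReal_cpow hP.le, Real.rpow_intCast]
  rw [e3, e4, ← mul_assoc, mul_comm ((p.PCD : ℂ) ^ _), hmb, integral_complex_ofReal]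
  congr 1
  have hint := integrable_rect_exp hν hh hP hΘ ha0 (by linarith : -(ς : ℝ) < a)
  have e5 : ∀ q : ℝ × ℝ, p.ν * q.1 ^ (p.ν * a - 1) * q.2 ^ ((ς : ℝ) - 1) *
      Real.exp (-(q.1 ^ p.ν / q.2 * p.Θ)) = p.ν * (q.1 ^ (p.ν * a - 1) * q.2 ^ ((ς : ℝ) - 1) *
      Real.exp (-(q.1 ^ p.ν / q.2 * p.Θ))) := fun q => by ring
  simp only [e5]
  rw [integral_const_mul, integral_prod _ hint, intervalIntegral.integral_of_le hh.le]
  simp only [mul_assoc, integral_const_mul, ← hνa]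

/-- The inner integral over the excess power. -/
def excessIntegral (p : Params) (ς : ℤ) (w : ℝ) : ℝ :=
  ∫ t in Ioc 0 p.PCD, t ^ ((ς : ℝ) - 1) * Real.exp (-(w ^ p.ν / t * p.Θ))

theorem intervalIntegrable_excessIntegral (hν : 0 < p.ν) (hΘ : 0 < p.Θ) (hP : 0 < p.PCD) {n : ℕ}
    {ς : ℤ} (hς : 1 - (n : ℤ) ≤ ς) {j : ℕ} (hj : 1 ≤ j) {h : ℝ} (hh : 0 < h) :
    IntervalIntegrable (fun w => w ^ (p.ν * n + j - 1) * p.excessIntegral ς w) volume 0 h := by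
  have hj' : (0 : ℝ) < j := by exact_mod_cast hj
  have hς' : (1 : ℝ) - n ≤ ς := by exact_mod_cast hς
  have hjν : 0 < (j : ℝ) / p.ν := by positivity
  have hint := (integrable_rect_exp (a := n + j / p.ν) (b := ς) hν hh hP hΘ (by positivity)
    (by linarith)).integral_prod_left
  rw [intervalIntegrable_iff_integrableOn_Ioc_of_le hh.le]
  have hνa : p.ν * (n + j / p.ν) = p.ν * n + j := by field_simp
  simp only [mul_assoc, integral_const_mul, hνa] at hint
  exact hint

/-- The indices j = 3 and j = 2 are the weights w² and w of the cone density, so the bracket matches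
`intervalIntegral_coneDensity_mul` term by term. -/
theorem bracket_eq (hν : 0 < p.ν) (hΘ : 0 < p.Θ) (hP : 0 < p.PCD) {n : ℕ} {ς : ℤ}
    (hς : 1 - (n : ℤ) ≤ ς) (h1 : 0 < p.h₁) (h12 : p.h₁ < p.h₂) (hc : 0 < Real.cos p.φ) :
    ((p.PCD ^ ς : ℝ) : ℂ) * p.bracket n ς =
      ((p.ν * ∫ w in p.h₁..(p.h₂ / Real.cos p.φ), coneDensity p.h₁ p.h₂ (Real.cos p.φ) w *
        (w ^ (p.ν * n) * p.excessIntegral ς w) : ℝ) : ℂ) := by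
  have h2 : 0 < p.h₂ := h1.trans h12
  have e3 : ∀ w, 0 < w → w ^ (p.ν * n + (3 : ℕ) - 1) * p.excessIntegral ς w =
      w ^ 2 * (w ^ (p.ν * n) * p.excessIntegral ς w) := by
    intro w hw
    rw [show p.ν * n + (3 : ℕ) - 1 = p.ν * n + (2 : ℕ) by push_cast; ring, Real.rpow_add hw,
      Real.rpow_natCast]
    ring
  have e2 : ∀ w, 0 < w → w ^ (p.ν * n + (2 : ℕ) - 1) * p.excessIntegral ς w =
      w * (w ^ (p.ν * n) * p.excessIntegral ς w) := by
    intro w hw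
    rw [show p.ν * n + (2 : ℕ) - 1 = p.ν * n + 1 by push_cast; ring, Real.rpow_add hw,
      Real.rpow_one]
    ring
  have i3 : ∀ h, 0 < h → IntervalIntegrable
      (fun w => w ^ 2 * (w ^ (p.ν * n) * p.excessIntegral ς w)) volume 0 h := fun h hh =>
    (intervalIntegrable_excessIntegral hν hΘ hP hς (j := 3) (by norm_num) hh).congr
      fun w hw => e3 w (by rw [uIoc_of_le hh.le] at hw; exact hw.1)
  have i2 : ∀ h, 0 < h → IntervalIntegrable
      (fun w => w * (w ^ (p.ν * n) * p.excessIntegral ς w)) volume 0 h := fun h hh =>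
    (intervalIntegrable_excessIntegral hν hΘ hP hς (j := 2) (by norm_num) hh).congr
      fun w hw => e2 w (by rw [uIoc_of_le hh.le] at hw; exact hw.1)
  have b3 : ∀ h, 0 < h → ((p.PCD ^ ς : ℝ) : ℂ) * p.boundaryTerm n ς 3 h =
      ((p.ν * ∫ w in 0..h, w ^ 2 * (w ^ (p.ν * n) * p.excessIntegral ς w) : ℝ) : ℂ) := by
    intro h hh
    rw [boundaryTerm_eq hν hΘ hP hς (by norm_num) hh]
    congr 2
    refine intervalIntegral.integral_congr_ae (Filter.Eventually.of_forall fun w hw => ?_)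
    rw [uIoc_of_le hh.le] at hw
    exact e3 w hw.1
  have b2 : ∀ h, 0 < h → ((p.PCD ^ ς : ℝ) : ℂ) * p.boundaryTerm n ς 2 h =
      ((p.ν * ∫ w in 0..h, w * (w ^ (p.ν * n) * p.excessIntegral ς w) : ℝ) : ℂ) := by
    intro h hh
    rw [boundaryTerm_eq hν hΘ hP hς (by norm_num) hh]
    congr 2
    refine intervalIntegral.integral_congr_ae (Filter.Eventually.of_forall fun w hw => ?_)
    rw [uIoc_of_le hh.le] at hw
    exact e2 w hw.1
  rw [intervalIntegral_coneDensity_mul h1 h12 hc (Real.cos_le_one _) i3 i2, bracket]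
  have p1c : 0 < p.h₁ / Real.cos p.φ := by positivity
  have p2c : 0 < p.h₂ / Real.cos p.φ := by positivity
  have t1 := b3 _ h2
  have t2 := b3 _ h1
  have t3 := b2 _ p1c
  have t4 := b2 _ h1
  have t5 := b3 _ p2c
  have t6 := b3 _ p1c
  have t7 := b2 _ p2c
  have t8 := b2 _ h2
  rw [Complex.ofReal_mul] at t1 t2 t3 t4 t5 t6 t7 t8
  simp only [Complex.ofReal_mul, Complex.ofReal_sub, Complex.ofReal_add]
  linear_combination t1 - t2 - p.h₁ * t3 + p.h₁ * t4 - Real.cos p.φ * t5 + Real.cos p.φ * t6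
    + p.h₂ * t7 - p.h₂ * t8

end A2A.Params

/-! ### Axisymmetric integration and Archimedes' theorem. -/

theorem volume_preserving_height :
    MeasurePreserving (fun x : 𝔼³ => (x 2, (x 0, x 1))) volume
      ((volume : Measure ℝ).prod ((volume : Measure ℝ).prod (volume : Measure ℝ))) := by
  have h1 := EuclideanSpace.volume_preserving_symm_measurableEquiv_toLp (Fin 3)
  have h2 := measurePreserving_piFinSuccAbove (fun _ : Fin 3 => (volume : Measure ℝ)) 2
  have h3 := (MeasurePreserving.id (volume : Measure ℝ)).prod (volume_preserving_finTwoArrow ℝ)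
  exact (h3.comp h2).comp h1

theorem lintegral_plane_radial {g : ℝ → ENNReal} (hg : Measurable g) :
    ∫⁻ q : ℝ × ℝ, g (√(q.1 ^ 2 + q.2 ^ 2)) =
      ENNReal.ofReal (2 * Real.pi) * ∫⁻ r in Ioi 0, ENNReal.ofReal r * g r := by
  rw [← lintegral_comp_polarCoord_symm, polarCoord_target, Measure.volume_eq_prod,
    ← Measure.prod_restrict]
  have : ∀ᵐ q : ℝ × ℝ ∂((volume.restrict (Ioi 0)).prod (volume.restrict (Ioo (-Real.pi) Real.pi))),
      ENNReal.ofReal q.1 • g (√((polarCoord.symm q).1 ^ 2 + (polarCoord.symm q).2 ^ 2)) =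
      (ENNReal.ofReal q.1 * g q.1) * 1 := by
    rw [Measure.prod_restrict]
    filter_upwards [ae_restrict_mem (measurableSet_Ioi.prod measurableSet_Ioo)] with q hq
    have h0 : (0 : ℝ) < q.1 := hq.1
    rw [polarCoord_symm_apply]
    simp only [smul_eq_mul, mul_one]
    rw [show (q.1 * Real.cos q.2) ^ 2 + (q.1 * Real.sin q.2) ^ 2 = q.1 ^ 2 by
      rw [mul_pow, mul_pow, ← mul_add, Real.cos_sq_add_sin_sq, mul_one], Real.sqrt_sq h0.le]
  rw [lintegral_congr_ae this, lintegral_prod_mul (f := fun r => ENNReal.ofReal r * g r)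
    (g := fun _ => 1) (by fun_prop) (by fun_prop)]
  simp only [lintegral_const, one_mul, Measure.restrict_apply MeasurableSet.univ, univ_inter,
    Real.volume_Ioo]
  rw [mul_comm, show Real.pi - -Real.pi = 2 * Real.pi by ring]

theorem lintegral_sin_mul_comp_cos (g : ℝ → ENNReal) :
    ∫⁻ θ in Ioo 0 Real.pi, ENNReal.ofReal (Real.sin θ) * g (Real.cos θ) =
      ∫⁻ c in Ioo (-1) 1, g c := by
  have himg : Real.cos '' Ioo 0 Real.pi = Ioo (-1) 1 := by
    ext c
    constructor
    · rintro ⟨θ, hθ, rfl⟩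
      have h1 := Real.strictAntiOn_cos (left_mem_Icc.2 Real.pi_pos.le) (Ioo_subset_Icc_self hθ) hθ.1
      have h2 := Real.strictAntiOn_cos (Ioo_subset_Icc_self hθ) (right_mem_Icc.2 Real.pi_pos.le)
        hθ.2
      rw [Real.cos_zero] at h1
      rw [Real.cos_pi] at h2
      exact ⟨h2, h1⟩
    · rintro ⟨h1, h2⟩
      exact ⟨Real.arccos c, ⟨Real.arccos_pos.2 h2, Real.arccos_lt_pi.2 h1⟩,
        Real.cos_arccos h1.le h2.le⟩
  rw [← himg, lintegral_image_eq_lintegral_abs_deriv_mul measurableSet_Ioo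
    (fun x _ => (Real.hasDerivAt_cos x).hasDerivWithinAt)
    (Real.injOn_cos.mono Ioo_subset_Icc_self)]
  refine setLIntegral_congr_fun measurableSet_Ioo fun θ hθ => ?_
  rw [abs_neg, abs_of_pos (Real.sin_pos_of_mem_Ioo hθ)]

theorem lintegral_halfPlane_polar {F : ℝ × ℝ → ENNReal} (hF : Measurable F) :
    ∫⁻ z : ℝ, ∫⁻ r in Ioi 0, ENNReal.ofReal r * F (z, r) =
      ∫⁻ w in Ioi 0, ENNReal.ofReal (w ^ 2) *
        ∫⁻ c in Ioo (-1) 1, F (w * c, w * √(1 - c ^ 2)) := by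
  -- Extension by zero to r ≤ 0 makes polar coordinates of the whole plane applicable; angles with
  -- sin θ ≤ 0 then contribute nothing.
  set f : ℝ × ℝ → ENNReal := fun q => (Ioi 0).indicator (fun r => ENNReal.ofReal r * F (q.1, r)) q.2
    with hf
  have hfm : Measurable f := by
    have : f = (Prod.snd ⁻¹' Ioi (0 : ℝ)).indicator (fun q => ENNReal.ofReal q.2 * F q) := by
      ext q; simp [hf, indicator]
    rw [this]
    exact Measurable.indicator (by fun_prop) (measurable_snd measurableSet_Ioi)
  have h1 : ∫⁻ z : ℝ, ∫⁻ r in Ioi 0, ENNReal.ofReal r * F (z, r) = ∫⁻ q, f q := by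
    rw [Measure.volume_eq_prod, lintegral_prod _ hfm.aemeasurable]
    refine lintegral_congr fun z => ?_
    rw [← lintegral_indicator measurableSet_Ioi]
  have hpm : Measurable fun q : ℝ × ℝ => ENNReal.ofReal q.1 • f (polarCoord.symm q) := by
    have h2 : Measurable fun q : ℝ × ℝ => polarCoord.symm q := by
      simp only [polarCoord_symm_apply]; fun_prop
    simp only [smul_eq_mul]
    exact (by fun_prop : Measurable fun q : ℝ × ℝ => ENNReal.ofReal q.1).mul (hfm.comp h2)
  rw [h1, ← lintegral_comp_polarCoord_symm, polarCoord_target, Measure.volume_eq_prod,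
    ← Measure.prod_restrict, lintegral_prod _ hpm.aemeasurable]
  refine setLIntegral_congr_fun measurableSet_Ioi fun w (hw : 0 < w) => ?_
  simp only [polarCoord_symm_apply, smul_eq_mul]
  have hsub : Ioo 0 Real.pi ⊆ Ioo (-Real.pi) Real.pi := Ioo_subset_Ioo_left (by
    have := Real.pi_pos; linarith)
  rw [← lintegral_sin_mul_comp_cos, ← lintegral_const_mul' _ _ ENNReal.ofReal_ne_top,
    ← lintegral_indicator measurableSet_Ioo, ← lintegral_indicator measurableSet_Ioo]
  refine lintegral_congr fun θ => ?_
  by_cases h0 : θ ∈ Ioo 0 Real.pi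
  · have hs := Real.sin_pos_of_mem_Ioo h0
    rw [indicator_of_mem h0, indicator_of_mem (hsub h0), hf]
    simp only
    rw [indicator_of_mem (show w * Real.sin θ ∈ Ioi 0 from mul_pos hw hs), ← Real.sin_sq,
      Real.sqrt_sq hs.le, ← mul_assoc, ← mul_assoc, ← ENNReal.ofReal_mul hw.le,
      ← ENNReal.ofReal_mul (by positivity)]
    congr 2
    ring
  · rw [indicator_of_notMem h0]
    by_cases h2 : θ ∈ Ioo (-Real.pi) Real.pi
    · rw [indicator_of_mem h2, hf]
      simp only
      rw [indicator_of_notMem, mul_zero]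
      have hθ : θ ≤ 0 := by
        by_contra h; exact h0 ⟨not_le.1 h, h2.2⟩
      have := Real.sin_nonpos_of_nonpos_of_neg_pi_le hθ h2.1.le
      simp only [mem_Ioi, not_lt]
      exact mul_nonpos_of_nonneg_of_nonpos hw.le this
    · rw [indicator_of_notMem h2]

/-- Spherical coordinates for functions that are symmetric about the third axis. -/
theorem lintegral_axisymmetric {F : ℝ × ℝ → ENNReal} (hF : Measurable F) :
    ∫⁻ x : 𝔼³, F (x 2, √(x 0 ^ 2 + x 1 ^ 2)) =
      ENNReal.ofReal (2 * Real.pi) * ∫⁻ w in Ioi 0, ENNReal.ofReal (w ^ 2) *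
        ∫⁻ c in Ioo (-1) 1, F (w * c, w * √(1 - c ^ 2)) := by
  have hm : Measurable fun q : ℝ × ℝ × ℝ => F (q.1, √(q.2.1 ^ 2 + q.2.2 ^ 2)) := by fun_prop
  have h1 := volume_preserving_height.lintegral_comp hm
  rw [h1, lintegral_prod _ hm.aemeasurable, ← lintegral_halfPlane_polar hF,
    ← lintegral_const_mul' _ _ ENNReal.ofReal_ne_top]
  refine lintegral_congr fun z => ?_
  exact lintegral_plane_radial (g := fun r => F (z, r)) (by fun_prop)

theorem norm_eq_sqrt_height (x : 𝔼³) : ‖x‖ = √(x 2 ^ 2 + √(x 0 ^ 2 + x 1 ^ 2) ^ 2) := by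
  rw [EuclideanSpace.norm_eq, Real.sq_sqrt (by positivity), Fin.sum_univ_three]
  simp only [Real.norm_eq_abs, sq_abs]
  congr 1
  ring

/-- Archimedes: the height of a uniform point of the unit sphere is uniform. -/
theorem map_height_toSphere :
    ((volume : Measure 𝔼³).toSphere).map (fun n : Metric.sphere (0 : 𝔼³) 1 => (n : 𝔼³) 2) =
      ENNReal.ofReal (2 * Real.pi) • (volume.restrict (Ioo (-1 : ℝ) 1)) := by
  have hmeas : Measurable (fun n : Metric.sphere (0 : 𝔼³) 1 => (n : 𝔼³) 2) := by fun_prop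
  ext B hB
  rw [Measure.map_apply hmeas hB, Measure.toSphere_apply' _ (hmeas hB)]
  -- The measure `toSphere` of a set is 3 times the volume of the open cone over it, which is here
  -- described by norm and normalised height.
  have hset : Ioo (0 : ℝ) 1 • (Subtype.val '' ((fun n : Metric.sphere (0 : 𝔼³) 1 =>
      (n : 𝔼³) 2) ⁻¹' B)) = {x : 𝔼³ | ‖x‖ ∈ Ioo 0 1 ∧ x 2 / ‖x‖ ∈ B} := by
    ext x
    rw [mem_smul]
    constructor
    · rintro ⟨t, ht, _, ⟨n, hn, rfl⟩, rfl⟩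
      have hnn : ‖(n : 𝔼³)‖ = 1 := by simp
      have hnorm : ‖t • (n : 𝔼³)‖ = t := by
        rw [norm_smul, hnn, mul_one, Real.norm_of_nonneg ht.1.le]
      refine ⟨by rw [hnorm]; exact ht, ?_⟩
      rw [hnorm]
      simpa [ht.1.ne'] using hn
    · rintro ⟨h1, h2⟩
      have h0 : ‖x‖ ≠ 0 := h1.1.ne'
      refine ⟨‖x‖, h1, ‖x‖⁻¹ • x, ⟨⟨‖x‖⁻¹ • x, ?_⟩, ?_, rfl⟩, ?_⟩
      · simp [norm_smul, h0]
      · simpa [div_eq_inv_mul] using h2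
      · simp [smul_smul, h0]
  set F : ℝ × ℝ → ENNReal := fun q => (Ioo (0 : ℝ) 1).indicator 1 (√(q.1 ^ 2 + q.2 ^ 2)) *
    B.indicator 1 (q.1 / √(q.1 ^ 2 + q.2 ^ 2)) with hF
  have hFm : Measurable F :=
    ((measurable_one.indicator measurableSet_Ioo).comp (by fun_prop)).mul
      ((measurable_one.indicator hB).comp (by fun_prop))
  have hvol : volume {x : 𝔼³ | ‖x‖ ∈ Ioo 0 1 ∧ x 2 / ‖x‖ ∈ B} =
      ∫⁻ x : 𝔼³, F (x 2, √(x 0 ^ 2 + x 1 ^ 2)) := by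
    rw [← lintegral_indicator_one]
    · refine lintegral_congr fun x => ?_
      rw [hF]
      simp only [← norm_eq_sqrt_height]
      by_cases a1 : ‖x‖ ∈ Ioo (0 : ℝ) 1 <;> by_cases a2 : x 2 / ‖x‖ ∈ B <;>
        simp only [indicator, mem_ofPred_eq, a1, a2, and_self, and_true, and_false, if_true,
          if_false, Pi.one_apply, mul_one, mul_zero]
    · refine MeasurableSet.inter ?_ ?_
      · exact (by fun_prop : Measurable fun x : 𝔼³ => ‖x‖) measurableSet_Ioo
      · exact (by fun_prop : Measurable fun x : 𝔼³ => x 2 / ‖x‖) hB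
  have hin : ∀ w ∈ Ioi (0 : ℝ), ENNReal.ofReal (w ^ 2) *
      (∫⁻ c in Ioo (-1) 1, F (w * c, w * √(1 - c ^ 2))) =
      (Ioo 0 1).indicator (fun w => ENNReal.ofReal (w ^ 2) * volume (B ∩ Ioo (-1 : ℝ) 1)) w := by
    intro w hw
    have hw0 : 0 < w := hw
    have hc : ∀ c ∈ Ioo (-1 : ℝ) 1, F (w * c, w * √(1 - c ^ 2)) =
        (Ioo 0 1).indicator 1 w * B.indicator 1 c := by
      intro c hc
      have h1 : 0 ≤ 1 - c ^ 2 := by nlinarith [hc.1, hc.2]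
      have h2 : √((w * c) ^ 2 + (w * √(1 - c ^ 2)) ^ 2) = w := by
        rw [mul_pow, mul_pow, Real.sq_sqrt h1, ← mul_add, add_sub_cancel, mul_one,
          Real.sqrt_sq hw0.le]
      rw [hF]
      simp only [h2, mul_div_cancel_left₀ _ hw0.ne']
    rw [setLIntegral_congr_fun measurableSet_Ioo hc, lintegral_const_mul' _ _ (by
      simp only [indicator]; split_ifs <;> simp), lintegral_indicator_one hB,
      Measure.restrict_apply hB]
    by_cases a1 : w ∈ Ioo (0 : ℝ) 1 <;> simp [a1]
  -- The radial integral 1/3 cancels the dimension 3 in `toSphere`.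
  have hw2 : ∫⁻ w in Ioo (0 : ℝ) 1, ENNReal.ofReal (w ^ 2) = ENNReal.ofReal (1 / 3) := by
    rw [← ofReal_integral_eq_lintegral_ofReal, ← integral_Ioc_eq_integral_Ioo,
      ← intervalIntegral.integral_of_le zero_le_one, integral_pow]
    · norm_num
    · exact (Continuous.integrableOn_Icc (by fun_prop)).mono_set Ioo_subset_Icc_self
    · exact Filter.Eventually.of_forall fun w => sq_nonneg w
  rw [hset, hvol, lintegral_axisymmetric hFm, setLIntegral_congr_fun measurableSet_Ioi hin,
    lintegral_indicator measurableSet_Ioo, Measure.restrict_restrict measurableSet_Ioo,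
    inter_eq_self_of_subset_left Ioo_subset_Ioi_self, lintegral_mul_const _ (by fun_prop), hw2]
  simp only [Measure.smul_apply, smul_eq_mul, Measure.restrict_apply hB, finrank_euclideanSpace,
    Fintype.card_fin]
  have h3 : ((3 : ℕ) : ENNReal) * ENNReal.ofReal (1 / 3) = 1 := by
    rw [← ENNReal.ofReal_natCast, ← ENNReal.ofReal_mul (by norm_num)]
    norm_num
  calc _ = (((3 : ℕ) : ENNReal) * ENNReal.ofReal (1 / 3)) *
        (ENNReal.ofReal (2 * Real.pi) * volume (B ∩ Ioo (-1 : ℝ) 1)) := by ring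
    _ = _ := by rw [h3, one_mul]

/-! ### The laws of the two distances. -/

theorem lintegral_comp_affine {a : ℝ} (ha : a ≠ 0) (b : ℝ) (G : ℝ → ENNReal) :
    ∫⁻ c, G (a * c + b) = ENNReal.ofReal |a|⁻¹ * ∫⁻ u, G u := by
  have hinj : InjOn (fun c : ℝ => a * c + b) univ := fun x _ y _ h => by
    simpa [ha] using h
  have himg : (fun c : ℝ => a * c + b) '' univ = univ := by
    rw [image_univ]
    exact Function.Surjective.range_eq fun u => ⟨(u - b) / a, by field_simp; ring⟩
  have h := lintegral_image_eq_lintegral_abs_deriv_mul MeasurableSet.univ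
    (fun x _ => (((hasDerivAt_id x).const_mul a).add_const b).hasDerivWithinAt) hinj G
  simp only [id, mul_one] at h
  rw [himg] at h
  simp only [Measure.restrict_univ] at h
  rw [lintegral_const_mul' _ _ ENNReal.ofReal_ne_top] at h
  rw [h, ← mul_assoc, ← ENNReal.ofReal_mul (by positivity), inv_mul_cancel₀ (by positivity),
    ENNReal.ofReal_one, one_mul]

theorem measurableSet_le_and_le_and_le {X : Type*} [MeasurableSpace X] {a b c d e f : X → ℝ}
    (ha : Measurable a) (hb : Measurable b) (hc : Measurable c) (hd : Measurable d)
    (he : Measurable e) (hf : Measurable f) :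
    MeasurableSet {x | a x ≤ b x ∧ c x ≤ d x ∧ e x ≤ f x} :=
  (measurableSet_le ha hb).inter ((measurableSet_le hc hd).inter (measurableSet_le he hf))

/-- The constant c cancels on normalising, so the image measure need only be known up to a factor.
-/
theorem map_of_isUniform {Ω E : Type*} [MeasurableSpace Ω] [MeasurableSpace E] {P : Measure Ω}
    {μ : Measure E} {s : Set E} {X : Ω → E} {d : E → ℝ} {ν : Measure ℝ} {c : ENNReal}
    (hX : Measurable X) (hd : Measurable d) (h : pdf.IsUniform X s P μ) (hc0 : c ≠ 0) (hc : c ≠ ⊤)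
    (hν : (μ.restrict s).map d = c • ν) :
    P.map (fun ω => d (X ω)) = (ν univ)⁻¹ • ν := by
  have h1 : P.map (fun ω => d (X ω)) = (P.map X).map d := (Measure.map_map hd hX).symm
  have h2 : μ s = c * ν univ := by
    have := congrArg (fun m : Measure ℝ => m univ) hν
    simpa [Measure.map_apply hd] using this
  rw [h1, h, ProbabilityTheory.cond, Measure.map_smul, hν, smul_smul, h2]
  congr 1
  rw [ENNReal.mul_inv (Or.inl hc0) (Or.inl hc), mul_right_comm, ENNReal.inv_mul_cancel hc0 hc,
    one_mul]

/-- At distance w from the apex, c is the cosine of the angle with the axis. Positive depth forces c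
> 0, and then the tangent condition is just cos φ ≤ c. -/
theorem volume_cap_inter {h₁ h₂ φ w : ℝ} (h1 : 0 < h₁) (hφ : φ ∈ Ioo 0 (Real.pi / 2)) (hw : 0 < w) :
    volume ({c : ℝ | h₁ ≤ w * c ∧ w * c ≤ h₂ ∧ w * √(1 - c ^ 2) ≤ w * c * Real.tan φ} ∩
      Ioo (-1 : ℝ) 1) =
      ENNReal.ofReal (min 1 (h₂ / w) - max (Real.cos φ) (h₁ / w)) := by
  have hcos : 0 < Real.cos φ :=
    Real.cos_pos_of_mem_Ioo ⟨by linarith [hφ.1, Real.pi_pos], hφ.2⟩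
  have hsin : 0 < Real.sin φ := Real.sin_pos_of_pos_of_lt_pi hφ.1 (by linarith [hφ.2, Real.pi_pos])
  have htan : 0 < Real.tan φ := by rw [Real.tan_eq_sin_div_cos]; positivity
  have ht : Real.tan φ ^ 2 * Real.cos φ ^ 2 = 1 - Real.cos φ ^ 2 := by
    rw [Real.tan_eq_sin_div_cos, div_pow, ← Real.sin_sq]; field_simp
  have hset : {c : ℝ | h₁ ≤ w * c ∧ w * c ≤ h₂ ∧ w * √(1 - c ^ 2) ≤ w * c * Real.tan φ} ∩
      Ioo (-1 : ℝ) 1 = Icc (max (Real.cos φ) (h₁ / w)) (h₂ / w) ∩ Ioo (-1 : ℝ) 1 := by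
    ext c
    simp only [mem_inter_iff, mem_ofPred_eq, mem_Icc, max_le_iff, and_congr_left_iff]
    rintro ⟨hc1, hc2⟩
    rw [div_le_iff₀ hw, le_div_iff₀ hw, mul_comm c w]
    have key : 0 < c → (w * √(1 - c ^ 2) ≤ w * c * Real.tan φ ↔ Real.cos φ ≤ c) := by
      intro hc
      rw [mul_assoc, mul_le_mul_iff_right₀ hw, Real.sqrt_le_left (by positivity),
        ← pow_le_pow_iff_left₀ hcos.le hc.le two_ne_zero, mul_pow]
      have hc2 : 0 < Real.cos φ ^ 2 := by positivity
      constructor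
      · intro h
        have := mul_le_mul_of_nonneg_right h hc2.le
        rw [mul_assoc, ht] at this
        linarith
      · intro h
        rw [← mul_le_mul_iff_left₀ hc2, mul_assoc, ht]
        linarith
    constructor
    · rintro ⟨a1, a2, a3⟩
      have hc : 0 < c := by
        by_contra h
        have := mul_nonpos_of_nonneg_of_nonpos hw.le (not_lt.1 h)
        linarith
      exact ⟨⟨(key hc).1 a3, a1⟩, a2⟩
    · rintro ⟨⟨a1, a2⟩, a3⟩
      exact ⟨a2, a3, (key (hcos.trans_le a1)).2 a1⟩
  -- If the resulting interval is empty, its formal length is at most 0 and `ENNReal.ofReal` returns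
  -- 0.
  rw [hset, measure_congr (Filter.EventuallyEq.rfl.inter Ioo_ae_eq_Icc), Icc_inter_Icc,
    Real.volume_Icc, sup_eq_left.2 (le_max_of_le_left (by linarith : (-1 : ℝ) ≤ Real.cos φ)),
    inf_comm]

theorem inner_eq_coneDensity {h₁ h₂ c w : ℝ} (hw : 0 < w) :
    w ^ 2 * (min 1 (h₂ / w) - max c (h₁ / w)) = coneDensity h₁ h₂ c w := by
  have hw2 : (0 : ℝ) ≤ w ^ 2 := by positivity
  rw [coneDensity, mul_sub, mul_min_of_nonneg _ _ hw2, mul_max_of_nonneg _ _ hw2]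
  congr 2
  · ring
  · field_simp
  · ring
  · field_simp

namespace A2A.Params
variable {p : Params}

theorem cos_φ_pos (hp : p.Valid) : 0 < Real.cos p.φ :=
  Real.cos_pos_of_mem_Ioo ⟨by linarith [hp.φ_mem.1, Real.pi_pos], hp.φ_mem.2⟩

theorem tan_φ_pos (hp : p.Valid) : 0 < Real.tan p.φ :=
  Real.tan_pos_of_pos_of_lt_pi_div_two hp.φ_mem.1 hp.φ_mem.2

/-- The measure on distances induced by the volume of the truncated cone, up to a constant. -/
def coneMeasure (p : Params) : Measure ℝ :=
  (volume.restrict (Icc p.h₁ (p.h₂ / Real.cos p.φ))).withDensity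
    fun w => ENNReal.ofReal (coneDensity p.h₁ p.h₂ (Real.cos p.φ) w)

theorem map_dist_truncatedCone (hp : p.Valid) :
    ((volume : Measure 𝔼³).restrict p.truncatedCone).map (fun x => dist p.posR x) =
      ENNReal.ofReal (2 * Real.pi) • p.coneMeasure := by
  have hdm : Measurable (fun x : 𝔼³ => dist p.posR x) := by fun_prop
  have hTm : MeasurableSet p.truncatedCone := by
    unfold truncatedCone
    exact measurableSet_le_and_le_and_le (by fun_prop) (by fun_prop) (by fun_prop)
      (by fun_prop) (by fun_prop) (by fun_prop)
  refine Measure.ext_of_lintegral _ fun F hF => ?_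
  set D : Set (ℝ × ℝ) := {q | p.h₁ ≤ q.1 ∧ q.1 ≤ p.h₂ ∧ q.2 ≤ q.1 * Real.tan p.φ} with hD
  have hDm : MeasurableSet D := by
    exact measurableSet_le_and_le_and_le (by fun_prop) (by fun_prop) (by fun_prop)
      (by fun_prop) (by fun_prop) (by fun_prop)
  set F' : ℝ × ℝ → ENNReal := D.indicator (fun q => F (√(q.1 ^ 2 + q.2 ^ 2))) with hF'
  have hF'm : Measurable F' := Measurable.indicator (by fun_prop) hDm
  have hR2 : p.posR 2 = p.wer := by simp [posR]
  have hR1 : p.posR 1 = 0 := by simp [posR]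
  have hR0 : p.posR 0 = 0 := by simp [posR]
  have h1 : ∫⁻ x in p.truncatedCone, F (dist p.posR x) =
      ∫⁻ y : 𝔼³, F' (y 2, √(y 0 ^ 2 + y 1 ^ 2)) := by
    -- The point reflection x = R − y puts the apex at the origin and makes the depth the third
    -- coordinate.
    rw [← lintegral_indicator hTm, ← lintegral_sub_left_eq_self _ p.posR]
    refine lintegral_congr fun y => ?_
    have hmem : p.posR - y ∈ p.truncatedCone ↔ (y 2, √(y 0 ^ 2 + y 1 ^ 2)) ∈ D := by
      simp only [truncatedCone, hD, mem_ofPred_eq, PiLp.sub_apply, hR2, hR1, hR0,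
        sub_sub_cancel, zero_sub, neg_sq]
    by_cases hy : (y 2, √(y 0 ^ 2 + y 1 ^ 2)) ∈ D
    · rw [indicator_of_mem (hmem.2 hy), hF', indicator_of_mem hy, dist_eq_norm, sub_sub_cancel,
        norm_eq_sqrt_height]
    · rw [indicator_of_notMem (mt hmem.1 hy), hF', indicator_of_notMem hy]
  rw [lintegral_map hF hdm, h1, lintegral_axisymmetric hF'm, lintegral_smul_measure, smul_eq_mul,
    coneMeasure, lintegral_withDensity_eq_lintegral_mul _
      ((continuous_coneDensity _ _ _).measurable.ennreal_ofReal) hF]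
  congr 1
  have h2 : ∀ w ∈ Ioi (0 : ℝ), ENNReal.ofReal (w ^ 2) *
      (∫⁻ c in Ioo (-1) 1, F' (w * c, w * √(1 - c ^ 2))) =
      (Icc p.h₁ (p.h₂ / Real.cos p.φ)).indicator (fun w =>
        ENNReal.ofReal (coneDensity p.h₁ p.h₂ (Real.cos p.φ) w) * F w) w := by
    intro w hw
    have hw0 : 0 < w := hw
    set s : Set ℝ := {c | p.h₁ ≤ w * c ∧ w * c ≤ p.h₂ ∧ w * √(1 - c ^ 2) ≤ w * c * Real.tan p.φ}
      with hs
    have hsm : MeasurableSet s := by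
      exact measurableSet_le_and_le_and_le (by fun_prop) (by fun_prop) (by fun_prop)
        (by fun_prop) (by fun_prop) (by fun_prop)
    have hc : ∀ c ∈ Ioo (-1 : ℝ) 1, F' (w * c, w * √(1 - c ^ 2)) =
        s.indicator (fun _ => F w) c := by
      intro c hc
      have h1 : 0 ≤ 1 - c ^ 2 := by nlinarith [hc.1, hc.2]
      have h2 : √((w * c) ^ 2 + (w * √(1 - c ^ 2)) ^ 2) = w := by
        rw [mul_pow, mul_pow, Real.sq_sqrt h1, ← mul_add, add_sub_cancel, mul_one,
          Real.sqrt_sq hw0.le]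
      have hiff : (w * c, w * √(1 - c ^ 2)) ∈ D ↔ c ∈ s := Iff.rfl
      by_cases hcs : c ∈ s
      · rw [hF', indicator_of_mem (hiff.2 hcs), indicator_of_mem hcs, h2]
      · rw [hF', indicator_of_notMem (mt hiff.1 hcs), indicator_of_notMem hcs]
    rw [setLIntegral_congr_fun measurableSet_Ioo hc, lintegral_indicator hsm, setLIntegral_const,
      Measure.restrict_apply hsm, volume_cap_inter hp.h₁_pos hp.φ_mem hw0, mul_left_comm,
      ← ENNReal.ofReal_mul (by positivity), inner_eq_coneDensity hw0]
    by_cases hwI : w ∈ Icc p.h₁ (p.h₂ / Real.cos p.φ)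
    · rw [indicator_of_mem hwI, mul_comm]
    · rw [indicator_of_notMem hwI, ENNReal.ofReal_of_nonpos
        (coneDensity_nonpos (cos_φ_pos hp) hw0 hwI), mul_zero]
  rw [setLIntegral_congr_fun measurableSet_Ioi h2, lintegral_indicator measurableSet_Icc,
    Measure.restrict_restrict measurableSet_Icc, inter_eq_self_of_subset_left]
  · rfl
  · exact fun w hw => hp.h₁_pos.trans_le hw.1

theorem coneMeasure_univ (hp : p.Valid) :
    p.coneMeasure univ = ENNReal.ofReal (Real.tan p.φ ^ 2 * (p.h₂ ^ 3 - p.h₁ ^ 3) / 6) := by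
  have hc := cos_φ_pos hp
  have hle : p.h₁ ≤ p.h₂ / Real.cos p.φ := by
    rw [le_div_iff₀ hc]
    nlinarith [Real.cos_le_one p.φ, hp.h₁_pos, hp.h₁_lt_h₂]
  rw [coneMeasure, withDensity_apply _ MeasurableSet.univ, Measure.restrict_univ,
    ← ofReal_integral_eq_lintegral_ofReal, integral_Icc_eq_integral_Ioc,
    ← intervalIntegral.integral_of_le hle,
    intervalIntegral_coneDensity hp.h₁_pos hp.h₁_lt_h₂ hc]
  · exact (continuous_coneDensity _ _ _).integrableOn_Icc
  · filter_upwards [ae_restrict_mem measurableSet_Icc] with w hw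
    exact coneDensity_nonneg hp.h₁_pos hp.h₁_lt_h₂.le hc (Real.cos_le_one _) hw

/-- With r = w_er + w_min, the squared distance of r n from R is r² + w_er² − 2 r w_er n₂, affine in
the height n₂, which is uniform by Archimedes. The zenith gives w_min², the horizon w_max². The
constant is r² · 2π / (2 r w_er). -/
theorem map_dist_orbitCap (hp : p.Valid) :
    (p.orbitArea.restrict p.orbitCap).map (fun x => dist x p.posR) =
      ENNReal.ofReal (2 * Real.pi * (p.wer + p.wmin) / (2 * p.wer)) •
        (volume.restrict (Icc (p.wmin ^ 2) (p.wmax ^ 2))).map Real.sqrt := by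
  have hwer : 0 < p.wer := add_pos_of_pos_of_nonneg hp.we_pos hp.wr_nonneg
  have hwm := hp.wmin_pos
  set r := p.wer + p.wmin with hr
  have hr0 : 0 < r := by positivity
  have hmax : p.wmax ^ 2 = r ^ 2 - p.wer ^ 2 := by
    rw [wmax, Real.sq_sqrt (by positivity), hr]; ring
  have hmin : p.wmin ^ 2 = r ^ 2 + p.wer ^ 2 - 2 * r * p.wer := by rw [hr]; ring
  have hdm : Measurable (fun x : 𝔼³ => dist x p.posR) := by fun_prop
  have hCm : MeasurableSet p.orbitCap := by
    have h1 : MeasurableSet {x : 𝔼³ | ‖x‖ = r} := measurableSet_eq_fun (by fun_prop) (by fun_prop)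
    have h2 : MeasurableSet {x : 𝔼³ | p.wer ≤ x 2} := measurableSet_le (by fun_prop) (by fun_prop)
    exact h1.inter h2
  refine Measure.ext_of_lintegral _ fun F hF => ?_
  set G : ℝ → ENNReal := (Icc (p.wmin ^ 2) (p.wmax ^ 2)).indicator (fun u => F (√u)) with hG
  have hGm : Measurable G := Measurable.indicator (by fun_prop) measurableSet_Icc
  have hR2 : p.posR 2 = p.wer := by simp [posR]
  have hR1 : p.posR 1 = 0 := by simp [posR]
  have hR0 : p.posR 0 = 0 := by simp [posR]
  have hn : ∀ n : Metric.sphere (0 : 𝔼³) 1, p.orbitCap.indicator (fun x => F (dist x p.posR))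
      (r • (n : 𝔼³)) = G (-(2 * r * p.wer) * (n : 𝔼³) 2 + (r ^ 2 + p.wer ^ 2)) := by
    intro n
    have hnn : ‖(n : 𝔼³)‖ = 1 := by simp
    have hsq : (n : 𝔼³) 0 ^ 2 + (n : 𝔼³) 1 ^ 2 + (n : 𝔼³) 2 ^ 2 = 1 := by
      have := EuclideanSpace.norm_sq_eq (n : 𝔼³)
      rw [hnn, Fin.sum_univ_three] at this
      simp only [Real.norm_eq_abs, sq_abs] at this
      linarith
    have hn1 : (n : 𝔼³) 2 ≤ 1 := by nlinarith [sq_nonneg ((n : 𝔼³) 0), sq_nonneg ((n : 𝔼³) 1)]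
    have hdist : dist (r • (n : 𝔼³)) p.posR =
        √(-(2 * r * p.wer) * (n : 𝔼³) 2 + (r ^ 2 + p.wer ^ 2)) := by
      rw [EuclideanSpace.dist_eq, Fin.sum_univ_three]
      simp only [Real.dist_eq, sq_abs, PiLp.smul_apply, smul_eq_mul, hR0, hR1, hR2]
      congr 1
      linear_combination r ^ 2 * hsq
    have hmem : r • (n : 𝔼³) ∈ p.orbitCap ↔
        -(2 * r * p.wer) * (n : 𝔼³) 2 + (r ^ 2 + p.wer ^ 2) ∈ Icc (p.wmin ^ 2) (p.wmax ^ 2) := by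
      rw [hmax, hmin]
      simp only [orbitCap, mem_ofPred_eq, norm_smul, hnn, PiLp.smul_apply, smul_eq_mul, mul_one,
        Real.norm_of_nonneg hr0.le, mem_Icc, ← hr, true_and]
      constructor
      · intro h
        constructor <;> nlinarith [mul_pos hr0 hwer]
      · rintro ⟨_, h⟩
        nlinarith
    by_cases h : r • (n : 𝔼³) ∈ p.orbitCap
    · rw [indicator_of_mem h, hG, indicator_of_mem (hmem.1 h), hdist]
    · rw [indicator_of_notMem h, hG, indicator_of_notMem (mt hmem.2 h)]
  -- Squared distances in [w_min², w_max²] only arise from heights in [−1, 1], so the affine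
  -- substitution can be made on the whole line.
  have hGsupp : ∫⁻ c in Ioo (-1 : ℝ) 1, G (-(2 * r * p.wer) * c + (r ^ 2 + p.wer ^ 2)) =
      ∫⁻ c, G (-(2 * r * p.wer) * c + (r ^ 2 + p.wer ^ 2)) := by
    rw [setLIntegral_congr Ioo_ae_eq_Icc, ← lintegral_indicator measurableSet_Icc]
    refine lintegral_congr fun c => ?_
    by_cases hc : c ∈ Icc (-1 : ℝ) 1
    · rw [indicator_of_mem hc]
    · rw [indicator_of_notMem hc, hG, indicator_of_notMem]
      rw [hmax, hmin]
      rintro ⟨a1, a2⟩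
      have hrw := mul_pos hr0 hwer
      refine hc ⟨?_, ?_⟩
      · by_contra h; nlinarith
      · by_contra h; nlinarith
  rw [lintegral_map hF hdm, ← lintegral_indicator hCm, orbitArea, lintegral_smul_measure,
    lintegral_map (Measurable.indicator (by fun_prop) hCm) (by fun_prop)]
  simp only [← hr, hn]
  have hheight : Measurable (fun n : Metric.sphere (0 : 𝔼³) 1 => (n : 𝔼³) 2) := by fun_prop
  have e1 := lintegral_map (μ := (volume : Measure 𝔼³).toSphere)
    (f := fun c => G (-(2 * r * p.wer) * c + (r ^ 2 + p.wer ^ 2))) (by fun_prop) hheight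
  rw [← e1, map_height_toSphere, lintegral_smul_measure, hGsupp, lintegral_comp_affine
    (by have := mul_pos hr0 hwer; linarith), lintegral_smul_measure, lintegral_map hF (by fun_prop),
    hG, lintegral_indicator measurableSet_Icc]
  simp only [smul_eq_mul]
  rw [← mul_assoc, ← mul_assoc, ← ENNReal.ofReal_mul (by positivity),
    ← ENNReal.ofReal_mul (by positivity), abs_neg, abs_of_pos (by positivity)]
  congr 2
  field_simp

end A2A.Params

/-! ### The Rician tail as a Poisson mixture. -/

/-- The probability that a Poisson variable with mean `v` is at most `m`. -/
def poissonCDFSum (m : ℕ) (v : ℝ) : ℝ :=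
  ∑ n ∈ Finset.range (m + 1), v ^ n / n.factorial * Real.exp (-v)

/-- The differentiated sum telescopes to its last term, the negative of an Erlang density;
`poissonCDFSum` is thus an Erlang tail. -/
theorem hasDerivAt_poissonCDFSum (m : ℕ) (v : ℝ) :
    HasDerivAt (poissonCDFSum m) (-(v ^ m / m.factorial * Real.exp (-v))) v := by
  have hexp : HasDerivAt (fun v : ℝ => Real.exp (-v)) (-Real.exp (-v)) v := by
    simpa using (hasDerivAt_neg v).exp
  induction m with
  | zero =>
    have : poissonCDFSum 0 = fun v : ℝ => Real.exp (-v) := by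
      ext v; simp [poissonCDFSum]
    rw [this]
    simpa using hexp
  | succ m ih =>
    have : poissonCDFSum (m + 1) = fun v : ℝ => poissonCDFSum m v +
        v ^ (m + 1) / (m + 1).factorial * Real.exp (-v) := by
      ext v; simp [poissonCDFSum, Finset.sum_range_succ _ (m + 1)]
    rw [this]
    have h2 := ih.add (((hasDerivAt_pow (m + 1) v).div_const ((m + 1).factorial : ℝ)).mul hexp)
    refine h2.congr_deriv ?_
    have h3 : ((m + 1).factorial : ℝ) = (m + 1) * m.factorial := by
      rw [Nat.factorial_succ]; push_cast; ring
    have h4 : (m.factorial : ℝ) ≠ 0 := by positivity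
    have h5 : (m + 1 : ℝ) ≠ 0 := by positivity
    rw [h3]
    push_cast
    field_simp
    ring

theorem tendsto_poissonCDFSum (m : ℕ) :
    Filter.Tendsto (poissonCDFSum m) Filter.atTop (nhds 0) := by
  have : Filter.Tendsto (poissonCDFSum m) Filter.atTop
      (nhds (∑ _n ∈ Finset.range (m + 1), 0)) := by
    refine tendsto_finsetSum _ fun n _ => ?_
    have h := (Real.tendsto_pow_mul_exp_neg_atTop_nhds_zero n).const_mul (n.factorial : ℝ)⁻¹
    rw [mul_zero] at h
    refine h.congr fun v => ?_
    ring
  simpa using this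

theorem poissonCDFSum_nonneg (m : ℕ) {v : ℝ} (hv : 0 ≤ v) : 0 ≤ poissonCDFSum m v :=
  Finset.sum_nonneg fun n _ => by positivity

theorem continuous_poissonCDFSum (m : ℕ) : Continuous (poissonCDFSum m) :=
  continuous_iff_continuousAt.2 fun v => (hasDerivAt_poissonCDFSum m v).continuousAt

theorem lintegral_erlang {κ x₀ : ℝ} (hκ : 0 < κ) (hx : 0 ≤ x₀) (m : ℕ) :
    ∫⁻ x in Ioi x₀, ENNReal.ofReal (κ * ((κ * x) ^ m / m.factorial * Real.exp (-(κ * x)))) =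
      ENNReal.ofReal (poissonCDFSum m (κ * x₀)) := by
  have hd : ∀ x, HasDerivAt (fun x => -poissonCDFSum m (κ * x))
      (κ * ((κ * x) ^ m / m.factorial * Real.exp (-(κ * x)))) x := by
    intro x
    have h := ((hasDerivAt_poissonCDFSum m (κ * x)).comp x
      ((hasDerivAt_id x).const_mul κ)).neg
    refine h.congr_deriv ?_
    simp only [mul_one]
    ring
  have hn : ∀ x ∈ Ioi x₀, 0 ≤ κ * ((κ * x) ^ m / m.factorial * Real.exp (-(κ * x))) := by
    intro x hx'
    have : 0 < x := hx.trans_lt hx'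
    positivity
  have ht : Filter.Tendsto (fun x => -poissonCDFSum m (κ * x)) Filter.atTop (nhds 0) := by
    have := ((tendsto_poissonCDFSum m).comp (Filter.tendsto_id.const_mul_atTop hκ)).neg
    simpa using this
  have hc : ContinuousWithinAt (fun x => -poissonCDFSum m (κ * x)) (Ici x₀) x₀ :=
    (hd x₀).continuousAt.continuousWithinAt
  rw [← ofReal_integral_eq_lintegral_ofReal
    (integrableOn_Ioi_deriv_of_nonneg hc (fun x _ => hd x) hn ht)
    ((ae_restrict_mem measurableSet_Ioi).mono hn),
    integral_Ioi_of_hasDerivAt_of_nonneg hc (fun x _ => hd x) hn ht, zero_sub, neg_neg]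

/-- The tail of the squared modulus of a Rician channel, normalised by `1 + K`. -/
def ricianTail (K v : ℝ) : ℝ :=
  ∑' m : ℕ, Real.exp (-K) * (K ^ m / m.factorial) * poissonCDFSum m v

theorem poissonCDFSum_le_one (m : ℕ) {v : ℝ} (hv : 0 ≤ v) : poissonCDFSum m v ≤ 1 := by
  rw [poissonCDFSum, ← Finset.sum_mul, Real.exp_neg, ← div_eq_mul_inv, div_le_one (Real.exp_pos _)]
  exact Real.sum_le_exp_of_nonneg hv _

theorem summable_ricianTail {K v : ℝ} (hK : 0 ≤ K) (hv : 0 ≤ v) :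
    Summable fun m : ℕ => Real.exp (-K) * (K ^ m / m.factorial) * poissonCDFSum m v := by
  refine Summable.of_nonneg_of_le (fun m => ?_) (fun m => ?_)
    ((Real.summable_pow_div_factorial K).mul_left (Real.exp (-K)))
  · have := poissonCDFSum_nonneg m hv
    positivity
  · exact mul_le_of_le_one_right (by positivity) (poissonCDFSum_le_one m hv)

theorem ricianTail_nonneg {K v : ℝ} (hK : 0 ≤ K) (hv : 0 ≤ v) : 0 ≤ ricianTail K v :=
  tsum_nonneg fun m => by have := poissonCDFSum_nonneg m hv; positivity

theorem measurable_ricianTail (K : ℝ) : Measurable (ricianTail K) :=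
  Measurable.tsum fun m => (continuous_poissonCDFSum m).measurable.const_mul _

namespace A2A.Params
variable {p : Params}

/-- The series of I₀ distributes e^{−K} K^m / m! as Poisson weights over Erlang densities of rate 1
+ K. All terms are nonnegative, so the tail may be taken term by term. -/
theorem ricianPDF_eq (hK : 0 ≤ p.K) {x : ℝ} (hx : 0 ≤ x) :
    HasSum (fun m : ℕ => Real.exp (-p.K) * (p.K ^ m / m.factorial) *
      ((1 + p.K) * (((1 + p.K) * x) ^ m / m.factorial * Real.exp (-((1 + p.K) * x)))))
      (p.ricianPDF x) := by
  set y := p.K * (1 + p.K) * x with hy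
  have hy0 : 0 ≤ y := by positivity
  have e1 : ∀ m : ℕ, 1 / (m.factorial : ℝ) ^ 2 * (2 * √y / 2) ^ (2 * m) =
      y ^ m / (m.factorial : ℝ) ^ 2 := by
    intro m
    rw [mul_div_cancel_left₀ _ two_ne_zero, pow_mul, Real.sq_sqrt hy0]
    ring
  have hs : Summable fun m : ℕ => y ^ m / (m.factorial : ℝ) ^ 2 := by
    refine Summable.of_nonneg_of_le (fun m => by positivity) (fun m => ?_)
      (Real.summable_pow_div_factorial y)
    have h1 : (1 : ℝ) ≤ m.factorial := by exact_mod_cast Nat.one_le_iff_ne_zero.2 m.factorial_ne_zero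
    gcongr
    nlinarith
  have h := hs.hasSum.mul_left ((1 + p.K) * Real.exp (-p.K - (1 + p.K) * x))
  rw [ricianPDF, if_pos hx, besselI0]
  simp only [← hy, e1]
  refine h.congr_fun fun m => ?_
  rw [sub_eq_add_neg, Real.exp_add, hy]
  have : (m.factorial : ℝ) ≠ 0 := by positivity
  rw [mul_assoc p.K, mul_pow p.K]
  field_simp

theorem ricianLaw_Ioi (hK : 0 ≤ p.K) {v : ℝ} (hv : 0 ≤ v) :
    (volume.withDensity fun x => ENNReal.ofReal (p.ricianPDF x)) (Ioi (v / (1 + p.K))) =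
      ENNReal.ofReal (ricianTail p.K v) := by
  have hκ : 0 < 1 + p.K := by linarith
  rw [withDensity_apply _ measurableSet_Ioi, ricianTail, ENNReal.ofReal_tsum_of_nonneg
    (fun m => by have := poissonCDFSum_nonneg m hv; positivity) (summable_ricianTail hK hv)]
  have h1 : ∀ x ∈ Ioi (v / (1 + p.K)), ENNReal.ofReal (p.ricianPDF x) =
      ∑' m : ℕ, ENNReal.ofReal (Real.exp (-p.K) * (p.K ^ m / m.factorial)) *
      ENNReal.ofReal ((1 + p.K) * (((1 + p.K) * x) ^ m / m.factorial *
        Real.exp (-((1 + p.K) * x)))) := by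
    intro x hx
    have hx0 : 0 ≤ x := (by positivity : 0 ≤ v / (1 + p.K)).trans (le_of_lt hx)
    have := ricianPDF_eq hK hx0
    rw [← this.tsum_eq, ENNReal.ofReal_tsum_of_nonneg (fun m => by positivity) this.summable]
    exact tsum_congr fun m => ENNReal.ofReal_mul (by positivity)
  rw [setLIntegral_congr_fun measurableSet_Ioi h1, lintegral_tsum (fun m => by fun_prop)]
  refine tsum_congr fun m => ?_
  rw [lintegral_const_mul' _ _ ENNReal.ofReal_ne_top, lintegral_erlang hκ (by positivity),
    mul_div_cancel₀ _ hκ.ne', ← ENNReal.ofReal_mul (by positivity)]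

end A2A.Params

/-! ### Joint expansion of tail and exponential, with a uniform summable bound. -/

/-- A term of the expansion of `ricianTail K v * exp y`. -/
def tailExpTerm (K v y : ℝ) (i : ℕ × ℕ × ℕ) : ℝ :=
  if i.2.1 ≤ i.1 then Real.exp (-K) * (K ^ i.1 / i.1.factorial) *
    (v ^ i.2.1 / i.2.1.factorial * Real.exp (-v)) * (y ^ i.2.2 / i.2.2.factorial) else 0

theorem pow_div_factorial_mul_exp_neg_le_one {v : ℝ} (hv : 0 ≤ v) (n : ℕ) :
    v ^ n / n.factorial * Real.exp (-v) ≤ 1 := by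
  rw [Real.exp_neg, ← div_eq_mul_inv, div_le_one (Real.exp_pos _)]
  exact Real.pow_div_factorial_le_exp v hv n

theorem summable_mul_mul {f g h : ℕ → ℝ} (hf : Summable fun n => ‖f n‖)
    (hg : Summable fun n => ‖g n‖) (hh : Summable fun n => ‖h n‖) :
    Summable fun i : ℕ × ℕ × ℕ => f i.1 * (g i.2.1 * h i.2.2) :=
  summable_mul_of_summable_norm (g := fun j : ℕ × ℕ => g j.1 * h j.2) hf
    (summable_mul_of_summable_norm hg hh).norm

theorem summable_tailExp_bound (K M : ℝ) :
    Summable fun i : ℕ × ℕ × ℕ => (2 * K) ^ i.1 / i.1.factorial *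
      ((1 / 2 : ℝ) ^ i.2.1 * (M ^ i.2.2 / i.2.2.factorial)) :=
  summable_mul_mul (f := fun m => (2 * K) ^ m / m.factorial) (g := fun n => (1 / 2 : ℝ) ^ n)
    (h := fun l => M ^ l / l.factorial) (Real.summable_pow_div_factorial (2 * K)).norm
    summable_geometric_two.norm (Real.summable_pow_div_factorial M).norm

/-- A Poisson weight is at most 1, uniformly in v, which matters since v = Θ w^ν / τ is unbounded as
τ ↓ 0. Decay in n comes from n ≤ m: then 1 ≤ 2^m 2^{−n}, at the price of replacing K by 2K. -/
theorem norm_tailExpTerm_le {K v y M : ℝ} (hK : 0 ≤ K) (hv : 0 ≤ v) (hy : |y| ≤ M)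
    (i : ℕ × ℕ × ℕ) : ‖tailExpTerm K v y i‖ ≤ (2 * K) ^ i.1 / i.1.factorial *
      ((1 / 2 : ℝ) ^ i.2.1 * (M ^ i.2.2 / i.2.2.factorial)) := by
  obtain ⟨m, n, l⟩ := i
  have hM : 0 ≤ M := (abs_nonneg y).trans hy
  simp only [tailExpTerm]
  split_ifs with h
  · have h1 := pow_div_factorial_mul_exp_neg_le_one hv n
    have h2 : Real.exp (-K) ≤ 1 := Real.exp_le_one_iff.2 (by linarith)
    have h3 : (1 : ℝ) ≤ 2 ^ m * (1 / 2) ^ n := by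
      rw [one_div, inv_pow, ← div_eq_mul_inv, one_le_div (by positivity)]
      exact pow_le_pow_right₀ (by norm_num) h
    rw [norm_mul, Real.norm_of_nonneg (by positivity), norm_div, norm_pow, Real.norm_eq_abs y,
      Real.norm_natCast]
    calc _ ≤ 1 * (K ^ m / m.factorial) * 1 * (M ^ l / l.factorial) := by gcongr
      _ = 1 * ((K ^ m / m.factorial) * (M ^ l / l.factorial)) := by ring
      _ ≤ (2 ^ m * (1 / 2) ^ n) * ((K ^ m / m.factorial) * (M ^ l / l.factorial)) := by gcongr
      _ = _ := by rw [mul_pow]; ring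
  · rw [norm_zero]; positivity

theorem hasSum_tailExpTerm {K v : ℝ} (y : ℝ) (hK : 0 ≤ K) (hv : 0 ≤ v) :
    HasSum (tailExpTerm K v y) (ricianTail K v * Real.exp y) := by
  have hs : Summable (tailExpTerm K v y) :=
    Summable.of_norm_bounded (summable_tailExp_bound K |y|) (norm_tailExpTerm_le hK hv le_rfl)
  refine hs.hasSum_iff.2 ?_
  rw [hs.tsum_prod, ricianTail, ← tsum_mul_right]
  refine tsum_congr fun m => ?_
  rw [(hs.prod_factor m).tsum_prod, tsum_eq_sum (s := Finset.range (m + 1)), poissonCDFSum,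
    Finset.mul_sum, Finset.sum_mul]
  · refine Finset.sum_congr rfl fun n hn => ?_
    have hn' : n ≤ m := Nat.lt_succ_iff.1 (Finset.mem_range.1 hn)
    simp only [tailExpTerm, hn', if_true]
    rw [tsum_mul_left, Real.exp_eq_exp_ℝ, NormedSpace.exp_eq_tsum_div]
  · intro n hn
    have hn' : ¬ n ≤ m := fun h => hn (Finset.mem_range.2 (Nat.lt_succ_iff.2 h))
    simp [tailExpTerm, hn']

/-- Dominated convergence: the bound on the terms does not depend on x, and constants are integrable
for a finite measure. -/
theorem hasSum_integral_tailExp {X : Type*} [MeasurableSpace X] {μ : Measure X} [IsFiniteMeasure μ]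
    {c v y : X → ℝ} {K B M : ℝ} (hK : 0 ≤ K) (hc : Measurable c) (hv : Measurable v)
    (hy : Measurable y) (hB : ∀ᵐ x ∂μ, |c x| ≤ B) (hv0 : ∀ᵐ x ∂μ, 0 ≤ v x)
    (hM : ∀ᵐ x ∂μ, |y x| ≤ M) :
    Integrable (fun x => c x * (ricianTail K (v x) * Real.exp (y x))) μ ∧
    HasSum (fun i => ∫ x, c x * tailExpTerm K (v x) (y x) i ∂μ)
      (∫ x, c x * (ricianTail K (v x) * Real.exp (y x)) ∂μ) := by
  set b : ℕ × ℕ × ℕ → ℝ := fun i => B * ((2 * K) ^ i.1 / i.1.factorial *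
      ((1 / 2 : ℝ) ^ i.2.1 * (M ^ i.2.2 / i.2.2.factorial))) with hb
  have hbs : Summable b := (summable_tailExp_bound K M).mul_left B
  have hbound : ∀ᵐ x ∂μ, ∀ i, ‖c x * tailExpTerm K (v x) (y x) i‖ ≤ b i := by
    filter_upwards [hB, hv0, hM] with x h1 h2 h3 i
    rw [norm_mul, Real.norm_eq_abs (c x)]
    exact mul_le_mul h1 (norm_tailExpTerm_le hK h2 h3 i) (norm_nonneg _)
      ((abs_nonneg _).trans h1)
  have hlim : ∀ᵐ x ∂μ, HasSum (fun i => c x * tailExpTerm K (v x) (y x) i)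
      (c x * (ricianTail K (v x) * Real.exp (y x))) := by
    filter_upwards [hv0] with x h2
    exact (hasSum_tailExpTerm (y x) hK h2).mul_left _
  constructor
  · have hmeas : Measurable (fun x => c x * (ricianTail K (v x) * Real.exp (y x))) :=
      hc.mul (((measurable_ricianTail K).comp hv).mul (by fun_prop))
    refine Integrable.of_bound hmeas.aestronglyMeasurable (∑' i, b i) ?_
    filter_upwards [hbound, hlim] with x h1 h2
    rw [← h2.tsum_eq]
    exact tsum_of_norm_bounded hbs.hasSum h1
  · refine hasSum_integral_of_dominated_convergence (fun i _ => b i) (fun i => ?_)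
      (fun i => hbound.mono fun x h => h i) (Filter.Eventually.of_forall fun _ => hbs)
      (integrable_const _) hlim
    refine Measurable.aestronglyMeasurable ?_
    simp only [tailExpTerm]
    split_ifs <;> fun_prop

/-! ### Signs of the parameters and the coverage event. -/

namespace A2A.Params
variable {p : Params}

theorem χρε_pos (hp : p.Valid) : 0 < p.χρε := by
  have h1 : 0 < 1 - p.ρ := by linarith [hp.ρ_mem.2]
  have h2 := hp.ρ_mem.1
  have h3 := hp.ε_mem.1
  refine mul_pos hp.χ_mem.1 ?_
  rcases hp.harvest with h | h
  · have : 0 < 2 * p.ρ / (1 - p.ρ) := by positivity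
    linarith
  · have : 0 ≤ 2 * p.ρ / (1 - p.ρ) := by positivity
    linarith

theorem με_pos (hp : p.Valid) : 0 < p.με := by
  have h1 : 0 < 1 - p.ε := by linarith [hp.ε_mem.2]
  have := hp.varR_pos
  have := hp.varRB_pos
  have := hp.μ_mem.1
  unfold με
  positivity

theorem D_pos (hp : p.Valid) : 0 < p.D :=
  mul_pos (mul_pos (με_pos hp) (χρε_pos hp)) hp.γ_pos

theorem Θ_pos (hp : p.Valid) : 0 < p.Θ := by
  have := hp.K_nonneg
  have := hp.varT_pos
  have := hp.γ_pos
  unfold Θ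
  positivity

theorem wer_pos (hp : p.Valid) : 0 < p.wer := add_pos_of_pos_of_nonneg hp.we_pos hp.wr_nonneg

theorem C_pos_iff (hp : p.Valid) : 0 < p.C ↔ p.γ < 1 / p.μ' := by
  have h1 := hp.μ_mem.1
  rw [C, mul_pos_iff_of_pos_left (mul_pos (χρε_pos hp) hp.η_pos), μ', one_div_div, lt_div_iff₀ h1,
    sub_pos, mul_comm]

theorem δ_nonneg (hp : p.Valid) : 0 ≤ p.δ := by
  have := hp.b_pos
  have := hp.Om_nonneg
  unfold δ
  positivity

theorem βbar_pos (hp : p.Valid) : 0 < p.βbar := by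
  have h1 := hp.b_pos
  have h2 := hp.Om_nonneg
  have h3 : (0 : ℝ) < p.msr := by exact_mod_cast hp.msr_pos
  have h4 : 0 < 2 * p.b * p.msr + p.Om := by positivity
  have : p.βbar = p.msr / (2 * p.b * p.msr + p.Om) := by
    unfold βbar β δ
    field_simp
    ring
  rw [this]
  positivity

theorem α_pos (hp : p.Valid) : 0 < p.α := by
  have h1 := hp.b_pos
  have h2 := hp.Om_nonneg
  have h3 : (0 : ℝ) < p.msr := by exact_mod_cast hp.msr_pos
  unfold α
  positivity

/-- (−1)^k (1 − m)_k is the product of the factors m − 1 − i over i < k, none of them negative. -/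
theorem ζ_nonneg (hp : p.Valid) {k : ℕ} (hk : k < p.msr) : 0 ≤ p.ζ k := by
  have h : ∀ j ≤ p.msr, 0 ≤ (-1 : ℝ) ^ j * (ascPochhammer ℝ j).eval (1 - (p.msr : ℝ)) := by
    intro j
    induction j with
    | zero => simp
    | succ j ih =>
      intro hj
      rw [ascPochhammer_succ_eval]
      have h1 : (j : ℝ) + 1 ≤ p.msr := by exact_mod_cast hj
      have := mul_nonneg (ih (by omega)) (by linarith : 0 ≤ (p.msr : ℝ) - 1 - j)
      rw [pow_succ]
      linarith
  have h1 := h k hk.le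
  have h2 := δ_nonneg hp
  unfold ζ
  positivity

theorem shadowedRicianPDF_nonneg (hp : p.Valid) (x : ℝ) : 0 ≤ p.shadowedRicianPDF x := by
  unfold shadowedRicianPDF
  split_ifs with h
  · refine mul_nonneg (α_pos hp).le (Finset.sum_nonneg fun k hk => ?_)
    have := ζ_nonneg hp (Finset.mem_range.1 hk)
    positivity
  · exact le_rfl

theorem measurable_shadowedRicianPDF : Measurable p.shadowedRicianPDF := by
  unfold shadowedRicianPDF
  exact Measurable.ite measurableSet_Ici (by fun_prop) measurable_const

/-- The denominator is positive because of the noise σ_t². After multiplying out, the condition is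
linear in y, with the excess power as coefficient. -/
theorem snr_gt_iff (hp : p.Valid) {σ y : ℝ} (hσ : 0 ≤ σ) (hy : 0 ≤ y) :
    p.γ < (1 - p.μ) * p.χρε * σ * y / (p.με * p.χρε * y + p.μ * p.χρε * σ * y + p.varT) ↔
      p.varT * p.γ < y * (σ * p.C / p.η - p.D) := by
  have h1 := χρε_pos hp
  have h2 := με_pos hp
  have h3 := hp.μ_mem.1
  have h4 := hp.varT_pos
  have h5 := hp.η_pos.ne'
  rw [lt_div_iff₀ (by positivity), C, D]
  have : y * (σ * (p.χρε * p.η * (1 - p.μ - p.μ * p.γ)) / p.η - p.με * p.χρε * p.γ) =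
      y * (σ * (p.χρε * (1 - p.μ - p.μ * p.γ)) - p.με * p.χρε * p.γ) := by
    field_simp
  rw [this, ← sub_pos, ← sub_pos (a := y * _)]
  ring_nf

theorem receivedPower_nonneg {Ω : Type*} {gsr : Ω → ℂ} {S : Ω → 𝔼³} (hp : p.Valid) (ω : Ω) :
    0 ≤ receivedPower p gsr S ω := by
  have := hp.η_pos
  unfold receivedPower
  positivity

theorem linkGain_nonneg {Ω : Type*} {grt : Ω → ℂ} {T : Ω → 𝔼³} (ω : Ω) : 0 ≤ linkGain p grt T ω := by
  unfold linkGain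
  positivity

/-- The event in terms of `((w_sr, |g_sr|²), (w_rt, |g_rt|²))`. -/
def coverageSet (p : Params) : Set ((ℝ × ℝ) × (ℝ × ℝ)) :=
  {q | 0 ≤ q.2.2 ∧ p.varT * p.γ < q.2.2 * q.2.1 ^ (-p.ν) * (q.1.2 * p.C / q.1.1 ^ 2 - p.D) ∧
    p.η * q.1.2 / q.1.1 ^ 2 ≤ p.Pth}

theorem measurableSet_coverageSet : MeasurableSet p.coverageSet := by
  have h1 : MeasurableSet {q : (ℝ × ℝ) × (ℝ × ℝ) | 0 ≤ q.2.2} :=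
    measurableSet_le (by fun_prop) (by fun_prop)
  have h2 : MeasurableSet {q : (ℝ × ℝ) × (ℝ × ℝ) |
      p.varT * p.γ < q.2.2 * q.2.1 ^ (-p.ν) * (q.1.2 * p.C / q.1.1 ^ 2 - p.D)} :=
    measurableSet_lt (by fun_prop) (by fun_prop)
  have h3 : MeasurableSet {q : (ℝ × ℝ) × (ℝ × ℝ) | p.η * q.1.2 / q.1.1 ^ 2 ≤ p.Pth} :=
    measurableSet_le (by fun_prop) (by fun_prop)
  exact h1.inter (h2.inter h3)

theorem event_eq_preimage {Ω : Type*} {gsr grt : Ω → ℂ} {S T : Ω → 𝔼³} (hp : p.Valid) :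
    {ω | p.γ < snrLinear p gsr grt S T ω ∧ receivedPower p gsr S ω ≤ p.Pth} =
      (fun ω => ((dist (S ω) p.posR, ‖gsr ω‖ ^ 2), (dist p.posR (T ω), ‖grt ω‖ ^ 2))) ⁻¹'
        p.coverageSet := by
  ext ω
  have hσ := receivedPower_nonneg (gsr := gsr) (S := S) hp ω
  have hy := linkGain_nonneg (p := p) (grt := grt) (T := T) ω
  have hσe : receivedPower p gsr S ω = p.η * ‖gsr ω‖ ^ 2 / dist (S ω) p.posR ^ 2 := by
    rw [receivedPower, zpow_neg, div_eq_mul_inv]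
    rfl
  simp only [mem_ofPred_eq, mem_preimage, coverageSet]
  rw [snrLinear, snr_gt_iff hp hσ hy, hσe, linkGain]
  have hη := hp.η_pos.ne'
  have : p.η * ‖gsr ω‖ ^ 2 / dist (S ω) p.posR ^ 2 * p.C / p.η =
      ‖gsr ω‖ ^ 2 * p.C / dist (S ω) p.posR ^ 2 := by
    field_simp
  rw [this]
  have h0 : 0 ≤ ‖grt ω‖ ^ 2 := by positivity
  simp only [h0, true_and]

/-! ### The probability as a triple integral. -/

section Event
variable {Ω : Type*} [MeasurableSpace Ω] {gsr grt : Ω → ℂ} {S T : Ω → 𝔼³} {P : Measure Ω}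

/-- On the event the excess power would have to be positive, but it is at most −D if C ≤ 0, and at
most P_{C,D} if C > 0. -/
theorem P3_eq_zero (hp : p.Valid) (h : p.C ≤ 0 ∨ (0 < p.C ∧ p.PCD ≤ 0)) :
    P3 p gsr grt S T P = 0 := by
  have hempty : {ω | p.γ < snrLinear p gsr grt S T ω ∧ receivedPower p gsr S ω ≤ p.Pth} = ∅ := by
    rw [eq_empty_iff_forall_notMem]
    rintro ω ⟨h1, h2⟩
    have hσ := receivedPower_nonneg (gsr := gsr) (S := S) hp ω
    have hy := linkGain_nonneg (p := p) (grt := grt) (T := T) ω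
    rw [snrLinear, snr_gt_iff hp hσ hy] at h1
    have hη := hp.η_pos
    have h3 : receivedPower p gsr S ω * p.C / p.η - p.D ≤ 0 := by
      rcases h with h | ⟨hC, h⟩
      · have h4 : receivedPower p gsr S ω * p.C / p.η ≤ 0 :=
          div_nonpos_of_nonpos_of_nonneg (mul_nonpos_of_nonneg_of_nonpos hσ h) hη.le
        linarith [D_pos hp]
      · have h4 : receivedPower p gsr S ω * p.C / p.η ≤ p.Pth * p.C / p.η := by gcongr
        unfold PCD at h
        linarith
    have := mul_nonpos_of_nonneg_of_nonpos hy h3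
    have := mul_pos hp.varT_pos hp.γ_pos
    linarith
  rw [P3, hempty, measureReal_empty]

theorem map_joint [IsProbabilityMeasure P] (hN : IsNetwork p gsr grt S T P) :
    P.map (fun ω => ((dist (S ω) p.posR, ‖gsr ω‖ ^ 2), (dist p.posR (T ω), ‖grt ω‖ ^ 2))) =
      ((P.map fun ω => dist (S ω) p.posR).prod (P.map fun ω => ‖gsr ω‖ ^ 2)).prod
        ((P.map fun ω => dist p.posR (T ω)).prod (P.map fun ω => ‖grt ω‖ ^ 2)) := by
  have m1 := hN.measurable_gsr
  have m2 := hN.measurable_grt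
  have m3 := hN.measurable_S
  have m4 := hN.measurable_T
  have d1 : Measurable fun ω => ‖gsr ω‖ ^ 2 := by fun_prop
  have d2 : Measurable fun ω => dist (S ω) p.posR := by fun_prop
  have d3 : Measurable fun ω => ‖grt ω‖ ^ 2 := by fun_prop
  have d4 : Measurable fun ω => dist p.posR (T ω) := by fun_prop
  have hm : ∀ i, Measurable (![fun ω => ‖gsr ω‖ ^ 2, fun ω => dist (S ω) p.posR,
    fun ω => ‖grt ω‖ ^ 2, fun ω => dist p.posR (T ω)] i) := by
    intro i
    fin_cases i
    · exact d1
    · exact d2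
    · exact d3
    · exact d4
  have h1 := hN.indep.indepFun_prodMk_prodMk hm 1 0 3 2 (by decide) (by decide) (by decide)
    (by decide)
  have h2 := hN.indep.indepFun (i := 1) (j := 0) (by decide)
  have h3 := hN.indep.indepFun (i := 3) (j := 2) (by decide)
  have e2 := (indepFun_iff_map_prod_eq_prod_map_map d2.aemeasurable d1.aemeasurable).1 h2
  have e3 := (indepFun_iff_map_prod_eq_prod_map_map d4.aemeasurable d3.aemeasurable).1 h3
  have e1 := (indepFun_iff_map_prod_eq_prod_map_map (d2.prodMk d1).aemeasurable
    (d4.prodMk d3).aemeasurable).1 h1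
  rw [e2, e3] at e1
  exact e1

/-- The probability of coverage for given distances and given `|g_sr|²` or excess power. -/
theorem ricianLaw_coverage (hp : p.Valid) {u w τ : ℝ} (hC : 0 < p.C) (hu : 0 < u) (hw : 0 < w) :
    (volume.withDensity fun x => ENNReal.ofReal (p.ricianPDF x))
      {y | ((√u, u / p.C * τ + u * p.D / p.C), (w, y)) ∈ p.coverageSet} =
      (Ioc 0 p.PCD).indicator
        (fun τ => ENNReal.ofReal (ricianTail p.K (w ^ p.ν / τ * p.Θ))) τ := by
  have hη := hp.η_pos
  -- The argument u τ / C + u D / C is the value of |g_sr|² whose excess power is τ.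
  have hτ : (u / p.C * τ + u * p.D / p.C) * p.C / √u ^ 2 - p.D = τ := by
    rw [Real.sq_sqrt hu.le]
    field_simp
    ring
  have hσ : p.η * (u / p.C * τ + u * p.D / p.C) / √u ^ 2 ≤ p.Pth ↔ τ ≤ p.PCD := by
    rw [Real.sq_sqrt hu.le, PCD, show p.η * (u / p.C * τ + u * p.D / p.C) / u =
      p.η * (τ + p.D) / p.C by field_simp, div_le_iff₀ hC, le_sub_iff_add_le, le_div_iff₀ hη,
      mul_comm p.η]
  simp only [coverageSet, mem_ofPred_eq, hτ, hσ]
  have hvγ := mul_pos hp.varT_pos hp.γ_pos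
  have hwν : 0 < w ^ (-p.ν) := by positivity
  by_cases h : τ ∈ Ioc 0 p.PCD
  · rw [indicator_of_mem h, ← ricianLaw_Ioi hp.K_nonneg
      (by have := h.1; have := Θ_pos hp; positivity)]
    congr 1
    ext y
    have hτ0 := h.1
    have hK : 0 < 1 + p.K := by linarith [hp.K_nonneg]
    have e : w ^ p.ν / τ * p.Θ / (1 + p.K) = p.varT * p.γ / (w ^ (-p.ν) * τ) := by
      rw [Θ, Real.rpow_neg hw.le]
      field_simp
    simp only [mem_ofPred_eq, h.2, and_true, mem_Ioi, e]
    rw [div_lt_iff₀ (by positivity), ← mul_assoc]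
    constructor
    · exact fun h => h.2
    · intro h2
      refine ⟨?_, h2⟩
      by_contra hy
      have : y * w ^ (-p.ν) * τ ≤ 0 :=
        mul_nonpos_of_nonpos_of_nonneg (mul_nonpos_of_nonpos_of_nonneg (not_le.1 hy).le hwν.le)
          hτ0.le
      linarith
  · rw [indicator_of_notMem h]
    refine measure_mono_null (t := ∅) ?_ measure_empty
    rintro y ⟨h1, h2, h3⟩
    exfalso
    have hτ0 : τ ≤ 0 := by
      by_contra h4; exact h ⟨not_le.1 h4, h3⟩
    -- This uses the clause 0 ≤ y of `coverageSet`: without it, negative y and negative τ could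
    -- satisfy the inequality.
    have : y * w ^ (-p.ν) * τ ≤ 0 := mul_nonpos_of_nonneg_of_nonpos (by positivity) hτ0
    linarith

/-- Lebesgue measure on the range of `(w_sr², w_rt, τ)`, with the excess power `τ`. -/
def rangeMeasure (p : Params) : Measure (ℝ × ℝ × ℝ) :=
  (volume.restrict (Icc (p.wmin ^ 2) (p.wmax ^ 2))).prod
    ((volume.restrict (Icc p.h₁ (p.h₂ / Real.cos p.φ))).prod (volume.restrict (Ioc 0 p.PCD)))

/-- The coverage probability density at `(w_sr², w_rt, τ)`, up to a constant. -/
def coverageDensity (p : Params) (x : ℝ × ℝ × ℝ) : ℝ :=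
  x.1 / p.C * p.shadowedRicianPDF (x.1 / p.C * x.2.2 + x.1 * p.D / p.C) *
    (coneDensity p.h₁ p.h₂ (Real.cos p.φ) x.2.1 * ricianTail p.K (x.2.1 ^ p.ν / x.2.2 * p.Θ))

theorem measurable_coverageDensity : Measurable p.coverageDensity := by
  have h1 : Measurable fun x : ℝ × ℝ × ℝ =>
      p.shadowedRicianPDF (x.1 / p.C * x.2.2 + x.1 * p.D / p.C) :=
    measurable_shadowedRicianPDF.comp (by fun_prop)
  have h2 : Measurable fun x : ℝ × ℝ × ℝ => coneDensity p.h₁ p.h₂ (Real.cos p.φ) x.2.1 :=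
    (continuous_coneDensity _ _ _).measurable.comp (by fun_prop)
  have h3 : Measurable fun x : ℝ × ℝ × ℝ => ricianTail p.K (x.2.1 ^ p.ν / x.2.2 * p.Θ) :=
    (measurable_ricianTail p.K).comp (by fun_prop)
  unfold coverageDensity
  fun_prop

theorem ae_rangeMeasure : ∀ᵐ x ∂p.rangeMeasure, x.1 ∈ Icc (p.wmin ^ 2) (p.wmax ^ 2) ∧
    x.2.1 ∈ Icc p.h₁ (p.h₂ / Real.cos p.φ) ∧ x.2.2 ∈ Ioc 0 p.PCD := by
  rw [rangeMeasure, Measure.prod_restrict, Measure.prod_restrict]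
  filter_upwards [ae_restrict_mem (measurableSet_Icc.prod (measurableSet_Icc.prod
    measurableSet_Ioc))] with x hx
  exact ⟨hx.1, hx.2.1, hx.2.2⟩

theorem map_dist_S [IsProbabilityMeasure P] (hp : p.Valid) (hN : IsNetwork p gsr grt S T P) :
    P.map (fun ω => dist (S ω) p.posR) = (ENNReal.ofReal (2 * p.wer * p.wmin))⁻¹ •
      (volume.restrict (Icc (p.wmin ^ 2) (p.wmax ^ 2))).map Real.sqrt := by
  have h1 := wer_pos hp
  have h2 := hp.wmin_pos
  rw [map_of_isUniform hN.measurable_S (by fun_prop) hN.uniform_S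
    (ENNReal.ofReal_pos.2 (by have := Real.pi_pos; positivity)).ne' ENNReal.ofReal_ne_top
    (map_dist_orbitCap hp)]
  congr 2
  rw [Measure.map_apply (by fun_prop) MeasurableSet.univ, preimage_univ, Measure.restrict_apply_univ,
    Real.volume_Icc, wmax, Real.sq_sqrt (by positivity), add_sub_cancel_left]

theorem map_dist_T [IsProbabilityMeasure P] (hp : p.Valid) (hN : IsNetwork p gsr grt S T P) :
    P.map (fun ω => dist p.posR (T ω)) =
      (ENNReal.ofReal (Real.tan p.φ ^ 2 * (p.h₂ ^ 3 - p.h₁ ^ 3) / 6))⁻¹ • p.coneMeasure := by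
  rw [map_of_isUniform hN.measurable_T (by fun_prop) hN.uniform_T
    (ENNReal.ofReal_pos.2 (by have := Real.pi_pos; positivity)).ne' ENNReal.ofReal_ne_top
    (map_dist_truncatedCone hp), coneMeasure_univ hp]

theorem cube_sub_pos (hp : p.Valid) : 0 < p.h₂ ^ 3 - p.h₁ ^ 3 :=
  sub_pos.2 (pow_lt_pow_left₀ hp.h₁_lt_h₂ hp.h₁_pos.le (by norm_num))

/-- Tonelli for the product law, with u outermost and |g_rt|² innermost. The whole computation takes
place in `ENNReal`; integrability serves only the return to real integrals. -/
theorem P3_eq_integral [IsProbabilityMeasure P] (hp : p.Valid) (hC : 0 < p.C)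
    (hN : IsNetwork p gsr grt S T P) (hint : Integrable p.coverageDensity p.rangeMeasure) :
    P3 p gsr grt S T P = (2 * p.wer * p.wmin)⁻¹ *
      (Real.tan p.φ ^ 2 * (p.h₂ ^ 3 - p.h₁ ^ 3) / 6)⁻¹ *
        ∫ x, p.coverageDensity x ∂p.rangeMeasure := by
  have m1 := hN.measurable_gsr
  have m2 := hN.measurable_grt
  have m3 := hN.measurable_S
  have m4 := hN.measurable_T
  have hwm := hp.wmin_pos
  have hAm := measurableSet_coverageSet (p := p)
  set μS := P.map (fun ω => dist (S ω) p.posR) with hμS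
  set μX := P.map (fun ω => ‖gsr ω‖ ^ 2) with hμX
  set μT := P.map (fun ω => dist p.posR (T ω)) with hμT
  set μY := P.map (fun ω => ‖grt ω‖ ^ 2) with hμY
  set cS := (ENNReal.ofReal (2 * p.wer * p.wmin))⁻¹ with hcS
  set cT := (ENNReal.ofReal (Real.tan p.φ ^ 2 * (p.h₂ ^ 3 - p.h₁ ^ 3) / 6))⁻¹ with hcT
  set g : ℝ × ℝ → ENNReal := fun q => (μT.prod μY) (Prod.mk q ⁻¹' p.coverageSet) with hg
  have hgm : Measurable g := measurable_measure_prodMk_left hAm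
  have hqm : Measurable fun w => ENNReal.ofReal (coneDensity p.h₁ p.h₂ (Real.cos p.φ) w) :=
    (continuous_coneDensity _ _ _).measurable.ennreal_ofReal
  have hgval : ∀ u ∈ Icc (p.wmin ^ 2) (p.wmax ^ 2), ∀ τ,
      g (√u, u / p.C * τ + u * p.D / p.C) = (Ioc 0 p.PCD).indicator (fun τ => cT *
        ∫⁻ w in Icc p.h₁ (p.h₂ / Real.cos p.φ),
          ENNReal.ofReal (coneDensity p.h₁ p.h₂ (Real.cos p.φ) w) *
            ENNReal.ofReal (ricianTail p.K (w ^ p.ν / τ * p.Θ))) τ := by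
    intro u hu τ
    have hu0 : 0 < u := lt_of_lt_of_le (by positivity) hu.1
    have hsm := measurable_prodMk_left (x := (√u, u / p.C * τ + u * p.D / p.C)) hAm
    rw [hg]
    simp only
    rw [Measure.prod_apply hsm, hμT, map_dist_T hp hN, lintegral_smul_measure, smul_eq_mul,
      coneMeasure, lintegral_withDensity_eq_lintegral_mul _ hqm (measurable_measure_prodMk_left hsm)]
    have h1 : ∀ w ∈ Icc p.h₁ (p.h₂ / Real.cos p.φ),
        ((fun w => ENNReal.ofReal (coneDensity p.h₁ p.h₂ (Real.cos p.φ) w)) * fun w =>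
          μY (Prod.mk w ⁻¹' (Prod.mk (√u, u / p.C * τ + u * p.D / p.C) ⁻¹' p.coverageSet))) w =
        ENNReal.ofReal (coneDensity p.h₁ p.h₂ (Real.cos p.φ) w) * (Ioc 0 p.PCD).indicator
          (fun τ => ENNReal.ofReal (ricianTail p.K (w ^ p.ν / τ * p.Θ))) τ := by
      intro w hw
      have h2 := ricianLaw_coverage hp (τ := τ) hC hu0 (hp.h₁_pos.trans_le hw.1)
      rw [← hN.law_grt] at h2
      rw [Pi.mul_apply, ← h2]
      rfl
    rw [setLIntegral_congr_fun measurableSet_Icc h1]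
    by_cases hτ : τ ∈ Ioc 0 p.PCD
    · simp only [indicator_of_mem hτ]
      rfl
    · simp only [indicator_of_notMem hτ, mul_zero, lintegral_zero]
  have hPE : P {ω | p.γ < snrLinear p gsr grt S T ω ∧ receivedPower p gsr S ω ≤ p.Pth} =
      cS * (cT * ∫⁻ x, ENNReal.ofReal (p.coverageDensity x) ∂p.rangeMeasure) := by
    rw [event_eq_preimage hp, ← Measure.map_apply (by fun_prop) hAm, map_joint hN,
      Measure.prod_apply hAm]
    change ∫⁻ q, g q ∂(μS.prod μX) = _
    rw [lintegral_prod _ hgm.aemeasurable, hμS, map_dist_S hp hN, lintegral_smul_measure,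
      smul_eq_mul, lintegral_map hgm.lintegral_prod_right' (by fun_prop), rangeMeasure,
      lintegral_prod _ measurable_coverageDensity.ennreal_ofReal.aemeasurable,
      ← lintegral_const_mul' cT _ (ENNReal.inv_ne_top.2 (ENNReal.ofReal_pos.2 (by
        have := cube_sub_pos hp
        have := tan_φ_pos hp
        positivity)).ne')]
    congr 1
    refine setLIntegral_congr_fun measurableSet_Icc fun u hu => ?_
    have hu0 : 0 < u := lt_of_lt_of_le (by positivity) hu.1
    have ha : u / p.C ≠ 0 := by positivity
    -- Substitution of τ for |g_sr|², whose Jacobian u / C becomes the first factor of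
    -- `coverageDensity`.
    have haff := lintegral_comp_affine ha (u * p.D / p.C) (fun x =>
      ENNReal.ofReal (p.shadowedRicianPDF x) * g (√u, x))
    have haff2 : ∫⁻ x, ENNReal.ofReal (p.shadowedRicianPDF x) * g (√u, x) =
        ENNReal.ofReal (u / p.C) * ∫⁻ τ, ENNReal.ofReal (p.shadowedRicianPDF
          (u / p.C * τ + u * p.D / p.C)) * g (√u, u / p.C * τ + u * p.D / p.C) := by
      rw [haff, ← mul_assoc, ← ENNReal.ofReal_mul (by positivity), abs_of_pos (by positivity),
        mul_inv_cancel₀ ha, ENNReal.ofReal_one, one_mul]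
    rw [hμX, hN.law_gsr, lintegral_withDensity_eq_lintegral_mul _
      measurable_shadowedRicianPDF.ennreal_ofReal (by fun_prop)]
    simp only [Pi.mul_apply]
    -- The order of w and τ is exchanged, because `hgval` integrates over w at fixed τ.
    rw [haff2, lintegral_prod_symm _ (by
      have := (measurable_coverageDensity (p := p)).ennreal_ofReal
      exact (this.comp measurable_prodMk_left).aemeasurable),
      ← lintegral_const_mul' _ _ ENNReal.ofReal_ne_top, ← lintegral_indicator measurableSet_Ioc,
      ← lintegral_const_mul' cT _ (ENNReal.inv_ne_top.2 (ENNReal.ofReal_pos.2 (by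
        have := cube_sub_pos hp
        have := tan_φ_pos hp
        positivity)).ne')]
    refine lintegral_congr fun τ => ?_
    rw [hgval u hu]
    by_cases hτ : τ ∈ Ioc 0 p.PCD
    · rw [indicator_of_mem hτ, indicator_of_mem hτ]
      have hf := shadowedRicianPDF_nonneg hp (u / p.C * τ + u * p.D / p.C)
      have e1 : ∀ w ∈ Icc p.h₁ (p.h₂ / Real.cos p.φ),
          ENNReal.ofReal (p.coverageDensity (u, (w, τ))) =
          ENNReal.ofReal (u / p.C * p.shadowedRicianPDF (u / p.C * τ + u * p.D / p.C)) *
          (ENNReal.ofReal (coneDensity p.h₁ p.h₂ (Real.cos p.φ) w) *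
            ENNReal.ofReal (ricianTail p.K (w ^ p.ν / τ * p.Θ))) := by
        intro w hw
        have hq := coneDensity_nonneg hp.h₁_pos hp.h₁_lt_h₂.le (cos_φ_pos hp) (Real.cos_le_one _) hw
        rw [← ENNReal.ofReal_mul hq, ← ENNReal.ofReal_mul (by positivity)]
        rfl
      rw [setLIntegral_congr_fun measurableSet_Icc e1,
        lintegral_const_mul' _ _ ENNReal.ofReal_ne_top, ENNReal.ofReal_mul (by positivity)]
      ring
    · rw [indicator_of_notMem hτ, indicator_of_notMem hτ]
      simp
  have hnn : 0 ≤ᵐ[p.rangeMeasure] p.coverageDensity := by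
    filter_upwards [ae_rangeMeasure (p := p)] with x hx
    obtain ⟨h1, h2, h3⟩ := hx
    have hu0 : 0 < x.1 := lt_of_lt_of_le (by positivity) h1.1
    have hw0 := hp.h₁_pos.trans_le h2.1
    have hq := coneDensity_nonneg hp.h₁_pos hp.h₁_lt_h₂.le (cos_φ_pos hp) (Real.cos_le_one _) h2
    have hf := shadowedRicianPDF_nonneg hp (x.1 / p.C * x.2.2 + x.1 * p.D / p.C)
    have ht := ricianTail_nonneg hp.K_nonneg (v := x.2.1 ^ p.ν / x.2.2 * p.Θ)
      (by have := h3.1; have := Θ_pos hp; positivity)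
    change 0 ≤ p.coverageDensity x
    unfold coverageDensity
    positivity
  have hZS : 0 ≤ 2 * p.wer * p.wmin := by have := wer_pos hp; positivity
  have hZT : 0 ≤ Real.tan p.φ ^ 2 * (p.h₂ ^ 3 - p.h₁ ^ 3) / 6 := by
    have := cube_sub_pos hp
    positivity
  rw [P3, measureReal_def, hPE, ← ofReal_integral_eq_lintegral_ofReal hint hnn, ENNReal.toReal_mul,
    ENNReal.toReal_mul, ENNReal.toReal_ofReal (integral_nonneg_of_ae hnn), hcS, hcT,
    ENNReal.toReal_inv, ENNReal.toReal_inv, ENNReal.toReal_ofReal hZS, ENNReal.toReal_ofReal hZT]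
  ring

end Event

end A2A.Params

/-! ### Expansion of the density and termwise integration. -/

namespace A2A

theorem deltaGamma_eq_integral {s a b : ℝ} (ha : 0 < a) (hab : a ≤ b) :
    deltaGamma s a b = ∫ t in a..b, t ^ (s - 1) * Real.exp (-t) := by
  have hint : ∀ x, 0 < x → IntegrableOn (fun t : ℝ => t ^ (s - 1) * Real.exp (-t)) (Ioi x) := by
    intro x hx
    refine integrable_of_isBigO_exp_neg (b := 1 / 2) (by norm_num) ?_ ?_
    · intro t ht
      have : t ≠ 0 := (hx.trans_le ht).ne'
      exact (ContinuousAt.mul (Real.continuousAt_rpow_const _ _ (Or.inl this))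
        (by fun_prop)).continuousWithinAt
    · simpa [mul_comm] using Real.Gamma_integrand_isLittleO (s - 1) |>.isBigO
  rw [deltaGamma, upperGamma, upperGamma, intervalIntegral.integral_Ioi_sub_Ioi (hint a ha) hab]

namespace Params
variable {p : Params}

/-- The factor of the coverage density that accompanies `ricianTail` and the exponential series. -/
def termWeight (p : Params) (k k₁ : ℕ) (x : ℝ × ℝ × ℝ) : ℝ :=
  p.α * p.ζ k * k.choose k₁ * p.D ^ (k - k₁) *
    ((x.1 / p.C) ^ (k + 1) * Real.exp (-(p.βbar * p.D / p.C * x.1))) *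
      (x.2.2 ^ k₁ * coneDensity p.h₁ p.h₂ (Real.cos p.φ) x.2.1)

theorem measurable_termWeight (k k₁ : ℕ) : Measurable (p.termWeight k k₁) := by
  have h : Measurable fun x : ℝ × ℝ × ℝ => coneDensity p.h₁ p.h₂ (Real.cos p.φ) x.2.1 :=
    (continuous_coneDensity _ _ _).measurable.comp (by fun_prop)
  unfold termWeight
  fun_prop

/-- Here |g_sr|² = (u/C)(τ + D). The binomial theorem gives k₁. Of the two exponential factors,
exp(−β̄ D u / C) stays in the weight for the incomplete Gamma functions, and exp(−β̄ u τ / C), which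
couples u and τ, is left for the power series in k₂. -/
theorem coverageDensity_eq_sum (hC : 0 < p.C) (hD : 0 < p.D) {x : ℝ × ℝ × ℝ} (hu : 0 ≤ x.1)
    (hτ : 0 ≤ x.2.2) :
    p.coverageDensity x = ∑ k ∈ Finset.range p.msr, ∑ k₁ ∈ Finset.range (k + 1),
      p.termWeight k k₁ x * (ricianTail p.K (x.2.1 ^ p.ν / x.2.2 * p.Θ) *
        Real.exp (-(p.βbar * x.1 * x.2.2 / p.C))) := by
  have harg : 0 ≤ x.1 / p.C * x.2.2 + x.1 * p.D / p.C := by positivity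
  rw [coverageDensity, shadowedRicianPDF, if_pos harg, ← βbar, Finset.mul_sum, Finset.mul_sum,
    Finset.sum_mul]
  refine Finset.sum_congr rfl fun k _ => ?_
  have e1 : (x.1 / p.C * x.2.2 + x.1 * p.D / p.C) ^ k = (x.1 / p.C) ^ k *
      ∑ k₁ ∈ Finset.range (k + 1), x.2.2 ^ k₁ * p.D ^ (k - k₁) * k.choose k₁ := by
    rw [← add_pow, ← mul_pow]
    congr 1
    ring
  have e2 : Real.exp (-p.βbar * (x.1 / p.C * x.2.2 + x.1 * p.D / p.C)) =
      Real.exp (-(p.βbar * p.D / p.C * x.1)) * Real.exp (-(p.βbar * x.1 * x.2.2 / p.C)) := by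
    rw [← Real.exp_add]
    congr 1
    ring
  rw [e1, e2]
  simp only [Finset.mul_sum, Finset.sum_mul]
  refine Finset.sum_congr rfl fun k₁ _ => ?_
  rw [termWeight]
  ring

instance : IsFiniteMeasure p.rangeMeasure := by
  unfold rangeMeasure
  infer_instance

theorem coneDensity_le_sq {h₁ h₂ c w : ℝ} (h1 : 0 ≤ h₁) (hw : 0 ≤ w) :
    coneDensity h₁ h₂ c w ≤ w ^ 2 := by
  have h2 : 0 ≤ max (c * w ^ 2) (h₁ * w) := le_max_of_le_right (by positivity)
  have h3 := min_le_left (w ^ 2) (h₂ * w)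
  unfold coneDensity
  linarith

theorem hasSum_integral_termWeight (hp : p.Valid) (hC : 0 < p.C) {k : ℕ} (hk : k < p.msr)
    (k₁ : ℕ) :
    Integrable (fun x => p.termWeight k k₁ x * (ricianTail p.K (x.2.1 ^ p.ν / x.2.2 * p.Θ) *
      Real.exp (-(p.βbar * x.1 * x.2.2 / p.C)))) p.rangeMeasure ∧
    HasSum (fun i => ∫ x, p.termWeight k k₁ x * tailExpTerm p.K (x.2.1 ^ p.ν / x.2.2 * p.Θ)
        (-(p.βbar * x.1 * x.2.2 / p.C)) i ∂p.rangeMeasure)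
      (∫ x, p.termWeight k k₁ x * (ricianTail p.K (x.2.1 ^ p.ν / x.2.2 * p.Θ) *
        Real.exp (-(p.βbar * x.1 * x.2.2 / p.C))) ∂p.rangeMeasure) := by
  have hD := D_pos hp
  have hβ := βbar_pos hp
  have hα := α_pos hp
  have hζ := ζ_nonneg hp hk
  have hΘ := Θ_pos hp
  have hwm := hp.wmin_pos
  refine hasSum_integral_tailExp (B := p.α * p.ζ k * k.choose k₁ * p.D ^ (k - k₁) *
    ((p.wmax ^ 2 / p.C) ^ (k + 1) * 1) * (p.PCD ^ k₁ * (p.h₂ / Real.cos p.φ) ^ 2))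
    (M := p.βbar * p.wmax ^ 2 * p.PCD / p.C)
    hp.K_nonneg (measurable_termWeight k k₁) (by fun_prop) (by fun_prop) ?_ ?_ ?_
  · filter_upwards [ae_rangeMeasure (p := p)] with x ⟨hu, hw, hτ⟩
    have hu0 : 0 < x.1 := lt_of_lt_of_le (by positivity) hu.1
    have hw0 := hp.h₁_pos.trans_le hw.1
    have hτ0 := hτ.1
    have hq := coneDensity_nonneg hp.h₁_pos hp.h₁_lt_h₂.le (cos_φ_pos hp) (Real.cos_le_one _) hw
    have hq2 : coneDensity p.h₁ p.h₂ (Real.cos p.φ) x.2.1 ≤ (p.h₂ / Real.cos p.φ) ^ 2 :=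
      (coneDensity_le_sq hp.h₁_pos.le hw0.le).trans (pow_le_pow_left₀ hw0.le hw.2 2)
    have he : Real.exp (-(p.βbar * p.D / p.C * x.1)) ≤ 1 :=
      Real.exp_le_one_iff.2 (neg_nonpos.2 (by positivity))
    have hτ2 := hτ.2
    have hu2 := hu.2
    have hP := hτ0.trans_le hτ2
    rw [termWeight, abs_of_nonneg (by positivity)]
    gcongr
  · filter_upwards [ae_rangeMeasure (p := p)] with x ⟨hu, hw, hτ⟩
    have hw0 := hp.h₁_pos.trans_le hw.1
    have hτ0 := hτ.1
    positivity
  · filter_upwards [ae_rangeMeasure (p := p)] with x ⟨hu, hw, hτ⟩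
    have hu0 : 0 < x.1 := lt_of_lt_of_le (by positivity) hu.1
    have hτ0 := hτ.1
    have hτ2 := hτ.2
    have hu2 := hu.2
    rw [abs_neg, abs_of_nonneg (by positivity)]
    gcongr

theorem integral_coverageDensity (hp : p.Valid) (hC : 0 < p.C) :
    Integrable p.coverageDensity p.rangeMeasure ∧ ∫ x, p.coverageDensity x ∂p.rangeMeasure =
      ∑ k ∈ Finset.range p.msr, ∑ k₁ ∈ Finset.range (k + 1),
        ∫ x, p.termWeight k k₁ x * (ricianTail p.K (x.2.1 ^ p.ν / x.2.2 * p.Θ) *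
          Real.exp (-(p.βbar * x.1 * x.2.2 / p.C))) ∂p.rangeMeasure := by
  have hwm := hp.wmin_pos
  have hae : (fun x => ∑ k ∈ Finset.range p.msr, ∑ k₁ ∈ Finset.range (k + 1),
      p.termWeight k k₁ x * (ricianTail p.K (x.2.1 ^ p.ν / x.2.2 * p.Θ) *
        Real.exp (-(p.βbar * x.1 * x.2.2 / p.C)))) =ᵐ[p.rangeMeasure] p.coverageDensity := by
    filter_upwards [ae_rangeMeasure (p := p)] with x ⟨hu, _, hτ⟩
    exact (coverageDensity_eq_sum hC (D_pos hp) ((by positivity : 0 ≤ p.wmin ^ 2).trans hu.1)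
      hτ.1.le).symm
  have hint : ∀ k ∈ Finset.range p.msr, ∀ k₁ ∈ Finset.range (k + 1), Integrable (fun x =>
      p.termWeight k k₁ x * (ricianTail p.K (x.2.1 ^ p.ν / x.2.2 * p.Θ) *
        Real.exp (-(p.βbar * x.1 * x.2.2 / p.C)))) p.rangeMeasure := fun k hk k₁ _ =>
    (hasSum_integral_termWeight hp hC (Finset.mem_range.1 hk) k₁).1
  constructor
  · exact (integrable_finsetSum _ fun k hk => integrable_finsetSum _ (hint k hk)).congr hae
  · rw [← integral_congr_ae hae, integral_finsetSum _
      fun k hk => integrable_finsetSum _ (hint k hk)]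
    exact Finset.sum_congr rfl fun k hk => integral_finsetSum _ (hint k hk)

end Params
end A2A

namespace A2A
namespace Params
variable {p : Params}

/-- Substitute t = β̄ D u / C; of the exponent k + l + 1, k comes from the fading density, l from
the exponential series and 1 from the Jacobian u / C. -/
theorem integral_pow_mul_exp_eq_deltaGamma (hp : p.Valid) (hC : 0 < p.C) (k l : ℕ) :
    ∫ u in Icc (p.wmin ^ 2) (p.wmax ^ 2), (u / p.C) ^ (k + l + 1) *
      Real.exp (-(p.βbar * p.D / p.C * u)) =
    p.C / (p.βbar * p.D) ^ (k + l + 2) * deltaGamma (k + l + 2)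
      (p.βbar * p.D * p.wmin ^ 2 / p.C) (p.βbar * p.D * p.wmax ^ 2 / p.C) := by
  have hβD : 0 < p.βbar * p.D := mul_pos (βbar_pos hp) (D_pos hp)
  have hwm := hp.wmin_pos
  have hwer := wer_pos hp
  have hle : p.wmin ^ 2 ≤ p.wmax ^ 2 := by
    rw [wmax, Real.sq_sqrt (by positivity)]
    have : 0 < 2 * p.wer * p.wmin := by positivity
    linarith
  have hle' : p.βbar * p.D * p.wmin ^ 2 / p.C ≤ p.βbar * p.D * p.wmax ^ 2 / p.C := by gcongr
  rw [deltaGamma_eq_integral (by positivity) hle', integral_Icc_eq_integral_Ioc,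
    ← intervalIntegral.integral_of_le hle]
  have h1 : ∀ a b : ℝ, ∫ t in a..b, t ^ ((k : ℝ) + l + 2 - 1) * Real.exp (-t) =
      ∫ t in a..b, t ^ (k + l + 1) * Real.exp (-t) := by
    intro a b
    have : (k : ℝ) + l + 2 - 1 = ((k + l + 1 : ℕ) : ℝ) := by push_cast; ring
    simp only [this, Real.rpow_natCast]
  have h2 := intervalIntegral.integral_comp_mul_left (a := p.wmin ^ 2) (b := p.wmax ^ 2)
    (fun t => t ^ (k + l + 1) * Real.exp (-t)) (c := p.βbar * p.D / p.C) (by positivity)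
  have h3 : ∀ u, (u / p.C) ^ (k + l + 1) * Real.exp (-(p.βbar * p.D / p.C * u)) =
      ((p.βbar * p.D) ^ (k + l + 1))⁻¹ * ((p.βbar * p.D / p.C * u) ^ (k + l + 1) *
        Real.exp (-(p.βbar * p.D / p.C * u))) := by
    intro u
    have h : (p.βbar * p.D / p.C * u) ^ (k + l + 1) =
        (p.βbar * p.D) ^ (k + l + 1) * (u / p.C) ^ (k + l + 1) := by
      rw [← mul_pow]; congr 1; ring
    rw [h, mul_assoc, inv_mul_cancel_left₀ (by positivity)]
  simp only [h3]
  rw [intervalIntegral.integral_const_mul, h2, h1, smul_eq_mul,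
    show p.βbar * p.D / p.C * p.wmin ^ 2 = p.βbar * p.D * p.wmin ^ 2 / p.C by ring,
    show p.βbar * p.D / p.C * p.wmax ^ 2 = p.βbar * p.D * p.wmax ^ 2 / p.C by ring]
  generalize (∫ t in _.._, t ^ (k + l + 1) * Real.exp (-t)) = I
  generalize p.βbar * p.D = X at hβD ⊢
  field_simp
  ring

/-- The integral over the cone that the Meijer G-functions evaluate. -/
def coneIntegral (p : Params) (n : ℕ) (ς : ℤ) : ℝ :=
  ∫ w in p.h₁..(p.h₂ / Real.cos p.φ), coneDensity p.h₁ p.h₂ (Real.cos p.φ) w *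
    (w ^ (p.ν * n) * p.excessIntegral ς w)

theorem h₁_le (hp : p.Valid) : p.h₁ ≤ p.h₂ / Real.cos p.φ := by
  rw [le_div_iff₀ (cos_φ_pos hp)]
  nlinarith [Real.cos_le_one p.φ, hp.h₁_pos, hp.h₁_lt_h₂]

/-- Since ς₁ − 1 = k₁ + l − n, the possibly singular powers combine into v^n with v = Θ w^ν / τ, and
v^n e^{−v} ≤ n! makes the integrand bounded near τ = 0. -/
theorem rpow_mul_excess_eq (hp : p.Valid) {w τ : ℝ} (hw : 0 < w) (hτ : 0 < τ) (n k₁ l : ℕ) :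
    w ^ (p.ν * n) * (τ ^ ((ς₁ n k₁ l : ℝ) - 1) * Real.exp (-(w ^ p.ν / τ * p.Θ))) =
      τ ^ (k₁ + l) * (p.Θ ^ n)⁻¹ * ((w ^ p.ν / τ * p.Θ) ^ n * Real.exp (-(w ^ p.ν / τ * p.Θ))) := by
  have hΘ := Θ_pos hp
  have e : ((ς₁ n k₁ l : ℤ) : ℝ) - 1 = ((k₁ + l : ℕ) : ℝ) - (n : ℕ) := by
    rw [ς₁]; push_cast; ring
  rw [e, Real.rpow_sub hτ, Real.rpow_natCast, Real.rpow_natCast, Real.rpow_mul hw.le,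
    Real.rpow_natCast, mul_pow, div_pow]
  field_simp

theorem integral_cone_excess (hp : p.Valid) (n k₁ l : ℕ) :
    ∫ q : ℝ × ℝ, coneDensity p.h₁ p.h₂ (Real.cos p.φ) q.1 * (q.1 ^ (p.ν * n) *
      (q.2 ^ ((ς₁ n k₁ l : ℝ) - 1) * Real.exp (-(q.1 ^ p.ν / q.2 * p.Θ))))
      ∂((volume.restrict (Icc p.h₁ (p.h₂ / Real.cos p.φ))).prod
        (volume.restrict (Ioc 0 p.PCD))) = p.coneIntegral n (ς₁ n k₁ l) := by
  have hΘ := Θ_pos hp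
  have hint : Integrable (fun q : ℝ × ℝ => coneDensity p.h₁ p.h₂ (Real.cos p.φ) q.1 *
      (q.1 ^ (p.ν * n) * (q.2 ^ ((ς₁ n k₁ l : ℝ) - 1) * Real.exp (-(q.1 ^ p.ν / q.2 * p.Θ)))))
      ((volume.restrict (Icc p.h₁ (p.h₂ / Real.cos p.φ))).prod
        (volume.restrict (Ioc 0 p.PCD))) := by
    refine Integrable.of_bound ?_ ((p.h₂ / Real.cos p.φ) ^ 2 *
      (p.PCD ^ (k₁ + l) * (p.Θ ^ n)⁻¹ * n.factorial)) ?_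
    · have h : Measurable fun q : ℝ × ℝ => coneDensity p.h₁ p.h₂ (Real.cos p.φ) q.1 :=
        (continuous_coneDensity _ _ _).measurable.comp (by fun_prop)
      refine Measurable.aestronglyMeasurable ?_
      fun_prop
    · rw [Measure.prod_restrict]
      filter_upwards [ae_restrict_mem (measurableSet_Icc.prod measurableSet_Ioc)] with q ⟨hw, hτ⟩
      have hw0 := hp.h₁_pos.trans_le hw.1
      have hτ0 := hτ.1
      have hτ2 := hτ.2
      have hP := hτ0.trans_le hτ2
      have hq := coneDensity_nonneg hp.h₁_pos hp.h₁_lt_h₂.le (cos_φ_pos hp) (Real.cos_le_one _) hw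
      have hq2 : coneDensity p.h₁ p.h₂ (Real.cos p.φ) q.1 ≤ (p.h₂ / Real.cos p.φ) ^ 2 :=
        (coneDensity_le_sq hp.h₁_pos.le hw0.le).trans (pow_le_pow_left₀ hw0.le hw.2 2)
      have hv : (q.1 ^ p.ν / q.2 * p.Θ) ^ n * Real.exp (-(q.1 ^ p.ν / q.2 * p.Θ)) ≤
          n.factorial := by
        have := pow_div_factorial_mul_exp_neg_le_one
          (by positivity : 0 ≤ q.1 ^ p.ν / q.2 * p.Θ) n
        rwa [div_mul_eq_mul_div, div_le_one (by positivity)] at this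
      rw [rpow_mul_excess_eq hp hw0 hτ0, Real.norm_of_nonneg (by positivity)]
      gcongr
  rw [integral_prod _ hint, coneIntegral, intervalIntegral.integral_of_le (h₁_le hp),
    integral_Icc_eq_integral_Ioc]
  simp only [integral_const_mul, excessIntegral]

theorem term_eq (hp : p.Valid) (hP : 0 < p.PCD) (k m n k₁ l : ℕ) :
    p.term k m n k₁ l = ((p.ζ k * Real.exp (-p.K) / p.βbar ^ (k + 2)
      * (p.K ^ m * p.Θ ^ n / (m.factorial * n.factorial)) * (k.choose k₁ : ℝ)
      * ((-1) ^ l / (l.factorial : ℝ)) * (1 / p.D ^ (k₁ + l + 2))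
      * deltaGamma (k + l + 2) (p.βbar * p.D * p.wmin ^ 2 / p.C)
          (p.βbar * p.D * p.wmax ^ 2 / p.C) * (p.ν * p.coneIntegral n (ς₁ n k₁ l)) : ℝ) : ℂ) := by
  have hb := bracket_eq (ς := ς₁ n k₁ l) hp.ν_pos (Θ_pos hp) hP (n := n)
    (by rw [ς₁]; omega) hp.h₁_pos hp.h₁_lt_h₂ (cos_φ_pos hp)
  rw [← coneIntegral] at hb
  rw [term, if_neg hP.ne', Complex.ofReal_mul _ (p.ν * _), ← hb]
  push_cast
  ring

/-- Once the exponential is expanded, each term is a function of u times a function of (w, τ), so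
its integral factors. -/
theorem termWeight_mul_ae_eq (hp : p.Valid) (k k₁ m n l : ℕ) :
    (fun x => p.termWeight k k₁ x * (Real.exp (-p.K) * (p.K ^ m / m.factorial) *
      ((x.2.1 ^ p.ν / x.2.2 * p.Θ) ^ n / n.factorial * Real.exp (-(x.2.1 ^ p.ν / x.2.2 * p.Θ))) *
        ((-(p.βbar * x.1 * x.2.2 / p.C)) ^ l / l.factorial))) =ᵐ[p.rangeMeasure]
      fun x => (p.α * p.ζ k * k.choose k₁ * p.D ^ (k - k₁) * (Real.exp (-p.K) *
        (p.K ^ m / m.factorial)) * (p.Θ ^ n / n.factorial) * ((-p.βbar) ^ l / l.factorial)) *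
        (((x.1 / p.C) ^ (k + l + 1) * Real.exp (-(p.βbar * p.D / p.C * x.1))) *
        (coneDensity p.h₁ p.h₂ (Real.cos p.φ) x.2.1 * (x.2.1 ^ (p.ν * n) *
          (x.2.2 ^ ((ς₁ n k₁ l : ℝ) - 1) * Real.exp (-(x.2.1 ^ p.ν / x.2.2 * p.Θ)))))) := by
  filter_upwards [ae_rangeMeasure (p := p)] with x ⟨hu, hw, hτ⟩
  have hw0 := hp.h₁_pos.trans_le hw.1
  have hΘn : p.Θ ^ n * (p.Θ ^ n)⁻¹ = 1 := mul_inv_cancel₀ (pow_pos (Θ_pos hp) n).ne'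
  rw [rpow_mul_excess_eq hp hw0 hτ.1, termWeight,
    show (-(p.βbar * x.1 * x.2.2 / p.C)) ^ l = (-p.βbar) ^ l * (x.1 / p.C) ^ l * x.2.2 ^ l by
      rw [← mul_pow, ← mul_pow]; congr 1; ring]
  generalize Real.exp (-(x.2.1 ^ p.ν / x.2.2 * p.Θ)) = E
  generalize (x.2.1 ^ p.ν / x.2.2 * p.Θ) ^ n = V
  generalize x.1 / p.C = U
  generalize (p.Θ ^ n)⁻¹ = R at hΘn ⊢
  generalize p.Θ ^ n = W at hΘn ⊢
  generalize Real.exp _ = E₁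
  generalize Real.exp _ = E₂
  generalize (m.factorial : ℝ) = a
  generalize (n.factorial : ℝ) = b
  generalize (l.factorial : ℝ) = d
  generalize coneDensity _ _ _ _ = q
  generalize x.2.2 = τ
  rw [pow_add, pow_add, pow_add, pow_add]
  linear_combination -(p.α * p.ζ k * k.choose k₁ * p.D ^ (k - k₁) * (E₁ * (p.K ^ m / a)) *
    ((-p.βbar) ^ l / d) * (U ^ k * U ^ l * U ^ 1 * E₂) * (q * τ ^ k₁ * τ ^ l * V * E) / b) * hΘn

theorem coefficient_identity {w m ν H t D B a b d α ζ c E Km Tn C G J : ℝ} {k k₁ : ℕ}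
    (hν : 0 < ν) (hD : 0 < D) (hB : 0 < B) (hk : k₁ ≤ k) (l : ℕ) :
    (2 * w * m)⁻¹ * (t ^ 2 * H / 6)⁻¹ * ((α * ζ * c * D ^ (k - k₁) * (E * (Km / a)) * (Tn / b) *
      ((-B) ^ l / d)) * ((C / (B * D) ^ (k + l + 2) * G) * J)) =
    3 * C * α / (w * m * ν * H * t ^ 2) * (ζ * E / B ^ (k + 2) * (Km * Tn / (a * b)) * c *
      ((-1) ^ l / d) * (1 / D ^ (k₁ + l + 2)) * G * (ν * J)) := by
  obtain ⟨e, rfl⟩ := Nat.exists_eq_add_of_le hk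
  have h1 : (B * D) ^ (k₁ + e + l + 2) =
      B ^ (k₁ + e + 2) * B ^ l * (D ^ e * D ^ (k₁ + l + 2)) := by
    rw [mul_pow, ← pow_add, ← pow_add]
    congr 2 <;> omega
  rw [Nat.add_sub_cancel_left, neg_pow B, h1]
  have hB1 : B ^ (k₁ + e + 2) ≠ 0 := by positivity
  have hB2 : B ^ l ≠ 0 := by positivity
  have hD1 : D ^ e ≠ 0 := by positivity
  have hD2 : D ^ (k₁ + l + 2) ≠ 0 := by positivity
  generalize B ^ (k₁ + e + 2) = B₁ at hB1 ⊢
  generalize B ^ l = B₂ at hB2 ⊢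
  generalize D ^ e = D₁ at hD1 ⊢
  generalize D ^ (k₁ + l + 2) = D₂ at hD2 ⊢
  generalize (-1 : ℝ) ^ l = s
  have hν0 := hν.ne'
  have i1 : B₂ * B₂⁻¹ = 1 := mul_inv_cancel₀ hB2
  have i2 : D₁ * D₁⁻¹ = 1 := mul_inv_cancel₀ hD1
  have i3 : ν * ν⁻¹ = 1 := mul_inv_cancel₀ hν0
  -- Only B^l, D^{k−k₁} and ν have to cancel. All other inverses occur on both sides and may be
  -- inverses of 0. The factor 3 is 6/2 from the two normalising constants.
  set Z : ℝ := 3 * C * α * ζ * c * E * Km * Tn * s * G * J * a⁻¹ * b⁻¹ * d⁻¹ * w⁻¹ * m⁻¹ *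
    (t ^ 2)⁻¹ * H⁻¹ * B₁⁻¹ * D₂⁻¹ with hZ
  calc _ = Z * (B₂ * B₂⁻¹) * (D₁ * D₁⁻¹) := by
        simp only [hZ, div_eq_mul_inv, mul_inv]
        ring
    _ = Z * (ν * ν⁻¹) := by rw [i1, i2, i3, mul_one]
    _ = _ := by
        simp only [hZ, div_eq_mul_inv, mul_inv]
        ring

theorem integral_termWeight (hp : p.Valid) (hC : 0 < p.C) (hP : 0 < p.PCD) {k k₁ : ℕ}
    (hk₁ : k₁ ≤ k) (i : ℕ × ℕ × ℕ) :
    (((2 * p.wer * p.wmin)⁻¹ * (Real.tan p.φ ^ 2 * (p.h₂ ^ 3 - p.h₁ ^ 3) / 6)⁻¹ *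
      ∫ x, p.termWeight k k₁ x * tailExpTerm p.K (x.2.1 ^ p.ν / x.2.2 * p.Θ)
        (-(p.βbar * x.1 * x.2.2 / p.C)) i ∂p.rangeMeasure : ℝ) : ℂ) =
    ((3 * p.C * p.α
      / (p.wer * p.wmin * p.ν * (p.h₂ ^ 3 - p.h₁ ^ 3) * Real.tan p.φ ^ 2) : ℝ) : ℂ) *
      if i.2.1 ≤ i.1 then p.term k i.1 i.2.1 k₁ i.2.2 else 0 := by
  obtain ⟨m, n, l⟩ := i
  have hwm := hp.wmin_pos
  by_cases hnm : n ≤ m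
  swap
  · simp [tailExpTerm, hnm]
  simp only [tailExpTerm, hnm, if_true]
  rw [term_eq hp hP, ← Complex.ofReal_mul]
  congr 1
  rw [integral_congr_ae (termWeight_mul_ae_eq hp k k₁ m n l), integral_const_mul, rangeMeasure,
    integral_prod_mul
      (fun u : ℝ => (u / p.C) ^ (k + l + 1) * Real.exp (-(p.βbar * p.D / p.C * u)))
      (fun q : ℝ × ℝ => coneDensity p.h₁ p.h₂ (Real.cos p.φ) q.1 * (q.1 ^ (p.ν * n) *
        (q.2 ^ ((ς₁ n k₁ l : ℝ) - 1) * Real.exp (-(q.1 ^ p.ν / q.2 * p.Θ))))),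
    integral_pow_mul_exp_eq_deltaGamma hp hC, integral_cone_excess hp]
  exact coefficient_identity hp.ν_pos (D_pos hp) (βbar_pos hp) hk₁ l

theorem hasSum_term (hp : p.Valid) (hC : 0 < p.C) (hP : 0 < p.PCD) {k k₁ : ℕ} (hk : k < p.msr)
    (hk₁ : k₁ ≤ k) :
    HasSum (fun i : ℕ × ℕ × ℕ => ((3 * p.C * p.α
      / (p.wer * p.wmin * p.ν * (p.h₂ ^ 3 - p.h₁ ^ 3) * Real.tan p.φ ^ 2) : ℝ) : ℂ) *
      if i.2.1 ≤ i.1 then p.term k i.1 i.2.1 k₁ i.2.2 else 0)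
    (((2 * p.wer * p.wmin)⁻¹ * (Real.tan p.φ ^ 2 * (p.h₂ ^ 3 - p.h₁ ^ 3) / 6)⁻¹ *
      ∫ x, p.termWeight k k₁ x * (ricianTail p.K (x.2.1 ^ p.ν / x.2.2 * p.Θ) *
        Real.exp (-(p.βbar * x.1 * x.2.2 / p.C))) ∂p.rangeMeasure : ℝ) : ℂ) := by
  simp only [← integral_termWeight hp hC hP hk₁]
  exact Complex.hasSum_ofReal.2 ((hasSum_integral_termWeight hp hC hk k₁).2.mul_left _)

/-- The finite sum over k₁ stands between the sums over n and k₂. Summability over ℕ³ for each k₁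
allows the iterated sum to be rearranged, with zeros for n > m. -/
theorem tsum_nested_eq {f : ℕ → ℕ → ℕ → ℕ → ℂ} {s : Finset ℕ} {a : ℕ → ℂ}
    (h : ∀ j ∈ s, HasSum (fun i : ℕ × ℕ × ℕ => if i.2.1 ≤ i.1 then f i.1 i.2.1 j i.2.2 else 0)
      (a j)) :
    ∑' m : ℕ, ∑ n ∈ Finset.range (m + 1), ∑ j ∈ s, ∑' l : ℕ, f m n j l = ∑ j ∈ s, a j := by
  have hsum := hasSum_sum h
  rw [← hsum.tsum_eq, hsum.summable.tsum_prod]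
  refine tsum_congr fun m => ?_
  rw [(hsum.summable.prod_factor m).tsum_prod, tsum_eq_sum (s := Finset.range (m + 1))]
  · refine Finset.sum_congr rfl fun n hn => ?_
    have hn' : n ≤ m := Nat.lt_succ_iff.1 (Finset.mem_range.1 hn)
    simp only [hn', if_true]
    refine (Summable.tsum_finsetSum fun j hj => ?_).symm
    simpa [hn'] using ((h j hj).summable.prod_factor m).prod_factor n
  · intro n hn
    have hn' : ¬ n ≤ m := fun h => hn (Finset.mem_range.2 (Nat.lt_succ_iff.2 h))
    simp [hn']

end Params
end A2A

end

/-! ### The three cases. -/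

theorem theorem3 {Ω : Type*} [MeasurableSpace Ω] (P : MeasureTheory.Measure Ω)
    [MeasureTheory.IsProbabilityMeasure P] (p : A2A.Params) (hp : p.Valid)
    (gsr grt : Ω → ℂ) (S T : Ω → EuclideanSpace ℝ (Fin 3))
    (hN : A2A.IsNetwork p gsr grt S T P) :
    (p.γ < 1 / p.μ' → p.D / p.C * p.η ≤ p.Pth →
      (∀ k < p.msr, ∀ k₁ ≤ k, Summable fun i : ℕ × ℕ × ℕ =>
        if i.2.1 ≤ i.1 then p.term k i.1 i.2.1 k₁ i.2.2 else 0) ∧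
      (A2A.P3 p gsr grt S T P : ℂ) = p.Ψ₁) ∧
    (p.γ < 1 / p.μ' → p.Pth < p.D / p.C * p.η → A2A.P3 p gsr grt S T P = 0) ∧
    (1 / p.μ' ≤ p.γ → A2A.P3 p gsr grt S T P = 0) := by
  have hη := hp.η_pos
  refine ⟨fun hγ hPth => ?_, fun hγ hPth => ?_, fun hγ => ?_⟩
  · have hC := (A2A.Params.C_pos_iff hp).2 hγ
    have hPCD : 0 ≤ p.PCD := by
      rw [A2A.Params.PCD, sub_nonneg, le_div_iff₀ hη]
      rwa [div_mul_eq_mul_div, div_le_iff₀ hC] at hPth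
    -- At P_{C,D} = 0 the event is empty and every term is 0 by convention, so both sides vanish.
    rcases hPCD.eq_or_lt with h0 | hP
    · have hterm : ∀ k m n k₁ k₂, p.term k m n k₁ k₂ = 0 := by
        intros
        rw [A2A.Params.term, if_pos h0.symm]
      refine ⟨fun k _ k₁ _ => by simpa only [hterm, ite_self] using summable_zero, ?_⟩
      rw [A2A.Params.P3_eq_zero hp (Or.inr ⟨hC, h0.symm.le⟩), A2A.Params.Ψ₁]
      simp [hterm]
    · have hcube := A2A.Params.cube_sub_pos hp
      have htan := A2A.Params.tan_φ_pos hp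
      have hwer := A2A.Params.wer_pos hp
      have hα := A2A.Params.α_pos hp
      have hwm := hp.wmin_pos
      have hν := hp.ν_pos
      set c : ℂ := ((3 * p.C * p.α
        / (p.wer * p.wmin * p.ν * (p.h₂ ^ 3 - p.h₁ ^ 3) * Real.tan p.φ ^ 2) : ℝ) : ℂ) with hc
      -- The expansion carries the prefactor c inside the series; c ≠ 0 transfers summability to the
      -- bare terms.
      have hc0 : c ≠ 0 := by
        rw [hc, Complex.ofReal_ne_zero]
        positivity
      have hsum := fun k (hk : k < p.msr) k₁ (hk₁ : k₁ ≤ k) =>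
        A2A.Params.hasSum_term hp hC hP hk hk₁
      have hsm := fun k (hk : k < p.msr) k₁ (hk₁ : k₁ ≤ k) =>
        (summable_mul_left_iff hc0).1 (hsum k hk k₁ hk₁).summable
      refine ⟨hsm, ?_⟩
      have hi := A2A.Params.integral_coverageDensity hp hC
      rw [A2A.Params.P3_eq_integral hp hC hN hi.1, hi.2, A2A.Params.Ψ₁, ← hc]
      simp only [Finset.mul_sum]
      rw [Complex.ofReal_sum]
      refine Finset.sum_congr rfl fun k hk => ?_
      rw [A2A.Params.tsum_nested_eq fun k₁ hk₁ =>
        (hsm k (Finset.mem_range.1 hk) k₁ (Nat.lt_succ_iff.1 (Finset.mem_range.1 hk₁))).hasSum,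
        Complex.ofReal_sum, Finset.mul_sum]
      refine Finset.sum_congr rfl fun k₁ hk₁ => ?_
      rw [← tsum_mul_left]
      exact (hsum k (Finset.mem_range.1 hk) k₁
        (Nat.lt_succ_iff.1 (Finset.mem_range.1 hk₁))).tsum_eq.symm
  · have hC := (A2A.Params.C_pos_iff hp).2 hγ
    refine A2A.Params.P3_eq_zero hp (Or.inr ⟨hC, ?_⟩)
    rw [A2A.Params.PCD, sub_nonpos, div_le_iff₀ hη]
    rw [div_mul_eq_mul_div, lt_div_iff₀ hC] at hPth
    exact hPth.le
  · exact A2A.Params.P3_eq_zero hp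
      (Or.inl (not_lt.1 fun h => not_lt.2 hγ ((A2A.Params.C_pos_iff hp).1 h)))
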